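/- **Theorem 5.1.** Let $f$ be a completely multiplicative function on the positive integers (so $f(1)=1$ and $f(mn)=f(m)f(n)$ for all $m,n$) with complex values and $|f(n)|\le 1$ for all $n$, and let $F(s)=\sum_{n\ge 1} f(n)n^{-s}$ be its Dirichlet series for $\mathrm{Re}(s)>1$. For $0<T\le 1$ and $0<\alpha\le 1$ put $$H_T(\alpha)=\Bigl(\sum_{k=-\infty}^{\infty}\ \max_{s\in\mathcal A_{k,T}(\alpha)}\Bigl|\frac{F(1+s)}{s}\Bigr|^2\Bigr)^{1/2},\qquad \mathcal A_{k,T}(\alpha)=\{s=\sigma+it:\ \alpha\le\sigma\le 1,\ |t-kT|\le T/2\}.$$ Let $x_0>e$ be a real number. Then there is a constant $C>0$, depending only on $x_0$, such that for all such $f$, all real $x\ge x_0$ and all real $0<T\le 1$, $$\Bigl|\sum_{n\le x}\frac{f(n)}{n}\Bigr|\le \frac{C}{\log x}\int_{1/\log x}^1\frac{H_T(\alpha)}{\alpha}\,d\alpha .$$ In particular, the implied constant is absolute for $x\ge 3$. -/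

import Mathlib

/-- The box of complex numbers `s = σ + it` with `α ≤ σ ≤ 1` and `|t - kT| ≤ T/2`. -/
def boxA (k : ℤ) (T α : ℝ) : Set ℂ :=
  {s : ℂ | α ≤ s.re ∧ s.re ≤ 1 ∧ |s.im - (k : ℝ) * T| ≤ T / 2}

/-- For a completely multiplicative `f` (Mathlib: a monoid-with-zero homomorphism, so `f 0 = 0` and
`f 1 = 1`) with Dirichlet series `F`, this is the square root of the sum over all integers `k` of
the maximum of `|F(1+s)/s|²` over the box with index `k`.

When `0 < α ≤ 1`, `0 < T` and `|f| ≤ 1`, each box is compact and nonempty and `F(1+s)/s` is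
continuous on it, so the supremum is a maximum; since `|F(1+s)|` is bounded on `α ≤ Re s`,
the series over `k` converges by comparison with `∑ 1/k²`. -/
noncomputable def HT (f : ℕ →*₀ ℂ) (T α : ℝ) : ℝ :=
  Real.sqrt (∑' k : ℤ, sSup ((fun s : ℂ => ‖LSeries (fun n => f n) (1 + s) / s‖ ^ 2) '' boxA k T α))

/-! Write s(v) = ∑_{n ≤ e^v} f(n)/n (`logSum`) and V = log x; the claim bounds V·|s(V)|.

Pointwise values reduce to an average. Splitting V = (V - log n) + log n, and using f·log = (fΛ) * f
for completely multiplicative f, gives V|s(V)| ≤ ∫_0^V |s| + ∑_d Λ(d)/d · |s(V - log d)|. Since s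
varies slowly, each |s(V - log d)| may be replaced by its mean over a window of length d^(-1/4). The
Selberg sieve bounds ∑ Λ over the resulting short intervals, so the windows pile up boundedly and
the sum over d is also ≪ 1 + ∫_0^V |s| (`exists_norm_logSum_mul_le`).

The average is bounded by Plancherel. The Laplace transform of s(v)·v·e^(-αv) on Re s = α is
-(F(1+s)/s)' = (F(1+s)/s)(-F'/F(1+s) + 1/s). On the stretch |t - kT| ≤ T/2 the first factor is at
most its maximum over the k-th box. The second factor has mean square ≪ 1/α over any interval of
length one, because a majorant principle compares -F'/F with -ζ'/ζ near its pole
(`exists_integral_norm_sq_LSeries_mul_vonMangoldt_le`). Hence the L² norm squared is ≪ H_T(α)²/α,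
and α = 2/V yields ∫_{V/2}^V |s| ≪ H_T(2/V).

As H_T is decreasing in α, H_T(2/V) ≤ 2∫_{1/V}^{2/V} H_T(α)/α dα, so dyadic summation gives ∫_0^V
|s| ≪ 1 + ∫_{1/V}^1 H_T(α)/α dα. Finally H_T ≥ 1/4, so the last integral is at least (log V)/4. This
is bounded below because x₀ > e, and the additive constants are absorbed. -/

section

/-! ### Plancherel's theorem for integrable, square-integrable functions. -/

open MeasureTheory FourierTransform SchwartzMap

theorem integral_smul_fourier_eq_of_integrable {g φ : ℝ → ℂ} (hg : Integrable g)
    (hφ : Integrable φ) : ∫ x, φ x * 𝓕 g x = ∫ x, 𝓕 φ x * g x := by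
  have h := VectorFourier.integral_fourierIntegral_smul_eq_flip (L := innerₗ ℝ)
    Real.continuous_fourierChar continuous_inner hφ hg
  rw [flip_innerₗ] at h
  exact h.symm

theorem continuous_fourier_of_integrable {g : ℝ → ℂ} (hg : Integrable g) : Continuous (𝓕 g) :=
  VectorFourier.fourierIntegral_continuous (L := innerₗ ℝ) Real.continuous_fourierChar
    continuous_inner hg

/-- The abstract L² transform agrees with the Fourier integral: tested against a smooth compactly
supported function, the transform moves to the test function by the distributional definition, and
back by the multiplication formula. -/
theorem fourier_toLp_ae_eq {g : ℝ → ℂ} (hg : Integrable g) (hg2 : MemLp g 2) :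
    (𝓕 (hg2.toLp g) : Lp ℂ 2 (volume : Measure ℝ)) =ᵐ[volume] 𝓕 g := by
  refine ae_eq_of_integral_contDiff_smul_eq ?_ ?_ ?_
  · exact (Lp.memLp _).locallyIntegrable (by norm_num)
  · exact (continuous_fourier_of_integrable hg).locallyIntegrable
  · intro φ hφ hφc
    have hc : HasCompactSupport (fun x => (φ x : ℂ)) := hφc.comp_left Complex.ofReal_zero
    have hd : ContDiff ℝ (↑(⊤ : ℕ∞)) (fun x => (φ x : ℂ)) := Complex.ofRealCLM.contDiff.comp hφ
    set Φ : 𝓢(ℝ, ℂ) := hc.toSchwartzMap hd with hΦ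
    have hΦv : ∀ x, Φ x = (φ x : ℂ) := fun x => rfl
    have key := congrArg (fun D => D Φ) (Lp.fourier_toTemperedDistribution_eq (hg2.toLp g))
    simp only [TemperedDistribution.fourier_apply, Lp.toTemperedDistribution_apply] at key
    have e1 : ∫ x, φ x • (𝓕 (hg2.toLp g) : Lp ℂ 2 (volume : Measure ℝ)) x
        = ∫ x, Φ x • (𝓕 (hg2.toLp g) : Lp ℂ 2 (volume : Measure ℝ)) x := by
      refine integral_congr_ae (.of_forall fun x => ?_)
      simp [hΦv]
    rw [e1, ← key]
    have e2 : ∫ x, (𝓕 Φ) x • (hg2.toLp g) x = ∫ x, (𝓕 Φ) x * g x := by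
      refine integral_congr_ae ?_
      filter_upwards [hg2.coeFn_toLp] with x hx
      rw [hx, smul_eq_mul]
    rw [e2, SchwartzMap.fourier_coe, ← integral_smul_fourier_eq_of_integrable hg Φ.integrable]
    refine integral_congr_ae (.of_forall fun x => ?_)
    simp [hΦv]

/-- Plancherel's theorem for a function that is both integrable and square integrable. -/
theorem lintegral_enorm_fourier_sq {g : ℝ → ℂ} (hg : Integrable g) (hg2 : MemLp g 2) :
    ∫⁻ x, ‖𝓕 g x‖ₑ ^ 2 = ∫⁻ x, ‖g x‖ₑ ^ 2 := by
  have h := Lp.norm_fourier_eq (hg2.toLp g)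
  have h2 : eLpNorm (𝓕 g) 2 volume = eLpNorm g 2 volume := by
    rw [← eLpNorm_congr_ae (fourier_toLp_ae_eq hg hg2), ← eLpNorm_congr_ae hg2.coeFn_toLp]
    rw [Lp.norm_def, Lp.norm_def] at h
    exact (ENNReal.toReal_eq_toReal_iff' (Lp.eLpNorm_ne_top _) (Lp.eLpNorm_ne_top _)).1 h
  have h3 := congrArg (fun t => t ^ (2 : ℝ)) h2
  simp only [eLpNorm_eq_lintegral_rpow_enorm_toReal (two_ne_zero) (ENNReal.ofNat_ne_top),
    ENNReal.toReal_ofNat, one_div] at h3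
  simp only [← ENNReal.rpow_mul, inv_mul_cancel₀ (two_ne_zero : (2 : ℝ) ≠ 0),
    ENNReal.rpow_one] at h3
  simpa only [ENNReal.rpow_ofNat] using h3

/-- Plancherel in the frequency variable t = 2πξ; the Jacobian 1/(2π) ≤ 1 is discarded. -/
theorem lintegral_enorm_sq_le_of_laplace {g G : ℝ → ℂ} (hg : Integrable g) (hg2 : MemLp g 2)
    (hG : ∀ t : ℝ, ∫ v, g v * Complex.exp (-(Complex.I * t * v)) = G t) :
    ∫⁻ v, ‖g v‖ₑ ^ 2 ≤ ∫⁻ t, ‖G t‖ₑ ^ 2 := by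
  have hF : ∀ ξ, 𝓕 g ξ = G (2 * Real.pi * ξ) := by
    intro ξ
    rw [Real.fourier_real_eq_integral_exp_smul, ← hG]
    refine integral_congr_ae (.of_forall fun v => ?_)
    simp only [smul_eq_mul]
    rw [mul_comm]
    congr 2
    push_cast
    ring
  have hmeas : Measurable fun t => ‖G t‖ₑ ^ 2 := by
    have : G = fun t => 𝓕 g ((2 * Real.pi)⁻¹ * t) := by
      funext t
      rw [hF]
      congr 1
      field_simp
    rw [this]
    have := continuous_fourier_of_integrable hg
    exact Continuous.measurable (by fun_prop)
  rw [← lintegral_enorm_fourier_sq hg hg2]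
  simp_rw [hF]
  have hm := Real.map_volume_mul_left (a := 2 * Real.pi) (by positivity)
  have h2 := lintegral_map (μ := volume) hmeas (measurable_const_mul (2 * Real.pi))
  rw [hm] at h2
  rw [← h2, lintegral_smul_measure]
  have : ENNReal.ofReal |(2 * Real.pi)⁻¹| ≤ 1 := by
    rw [ENNReal.ofReal_le_one, abs_of_pos (by positivity)]
    exact inv_le_one_of_one_le₀ (by linarith [Real.pi_gt_three])
  calc _ ≤ 1 * ∫⁻ t, ‖G t‖ₑ ^ 2 := by
        rw [smul_eq_mul]
        gcongr
    _ = _ := one_mul _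

end

/-! ### A majorant principle for exponential sums. -/

section

open MeasureTheory ComplexConjugate

/-- Positivity of the Fejér kernel: for ξ ≠ 0 the integral equals 2(1 - cos ξ)/ξ². -/
theorem integral_triangle_mul_cos_nonneg (ξ : ℝ) :
    0 ≤ ∫ t in (0 : ℝ)..1, (1 - t) * (2 * Real.cos (t * ξ)) := by
  rcases eq_or_ne ξ 0 with rfl | hξ
  · refine intervalIntegral.integral_nonneg zero_le_one fun t ht => ?_
    have := ht.2
    simp only [mul_zero, Real.cos_zero]
    nlinarith
  · have hd : ∀ t ∈ Set.uIcc (0 : ℝ) 1, HasDerivAt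
        (fun t : ℝ => 2 * ((1 - t) * Real.sin (t * ξ) / ξ - Real.cos (t * ξ) / ξ ^ 2))
        ((1 - t) * (2 * Real.cos (t * ξ))) t := by
      intro t _
      have h1 : HasDerivAt (fun t : ℝ => t * ξ) ξ t := by simpa using (hasDerivAt_id t).mul_const ξ
      have h2 : HasDerivAt (fun t : ℝ => 1 - t) (-1) t := by
        simpa using (hasDerivAt_id t).const_sub 1
      convert! (((h2.mul h1.sin).div_const ξ).sub (h1.cos.div_const (ξ ^ 2))).const_mul 2 using 1

      field_simp
      ring
    rw [intervalIntegral.integral_eq_sub_of_hasDerivAt hd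
      (Continuous.intervalIntegrable (by fun_prop) _ _)]
    simp only [sub_self, zero_mul, zero_div, one_mul, sub_zero, Real.sin_zero, mul_zero,
      Real.cos_zero, zero_sub]
    have := Real.cos_le_one ξ
    have h3 : 0 ≤ (1 - Real.cos ξ) / ξ ^ 2 := by
      apply div_nonneg <;> [linarith; positivity]
    have : 2 * -(Real.cos ξ / ξ ^ 2) - 2 * -(1 / ξ ^ 2) = 2 * ((1 - Real.cos ξ) / ξ ^ 2) := by ring
    rw [this]
    positivity

theorem norm_cexp_neg_I_mul (t l : ℝ) : ‖Complex.exp (-(Complex.I * t * l))‖ = 1 := by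
  rw [Complex.norm_exp]
  simp

theorem summable_norm_mul_cexp {a : ℕ → ℂ} (ha : Summable fun n => ‖a n‖) (l : ℕ → ℝ) (t : ℝ) :
    Summable fun n => ‖a n * Complex.exp (-(Complex.I * t * l n))‖ := by
  simpa only [norm_mul, norm_cexp_neg_I_mul, mul_one] using ha

theorem continuous_tsum_mul_cexp {a : ℕ → ℂ} (ha : Summable fun n => ‖a n‖) (l : ℕ → ℝ) :
    Continuous fun t : ℝ => ∑' n, a n * Complex.exp (-(Complex.I * t * l n)) := by
  refine continuous_tsum (fun n => by fun_prop) ha fun n t => ?_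
  rw [norm_mul, norm_cexp_neg_I_mul, mul_one]

/-- Squaring out gives a double sum with phases e^(-it(l_m - l_n)); adding the values at t and -t
turns the phases into real cosines, ready for the Fejér weight. -/
theorem hasSum_normSq_add_normSq_neg {a : ℕ → ℂ} (ha : Summable fun n => ‖a n‖) (l : ℕ → ℝ)
    (t : ℝ) :
    HasSum (fun p : ℕ × ℕ => a p.1 * conj (a p.2) *
        ((2 * Real.cos (t * (l p.1 - l p.2)) : ℝ) : ℂ))
      ((‖∑' n, a n * Complex.exp (-(Complex.I * t * l n))‖ ^ 2 +
        ‖∑' n, a n * Complex.exp (-(Complex.I * (-t : ℝ) * l n))‖ ^ 2 : ℝ) : ℂ) := by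
  have key : ∀ t : ℝ, HasSum (fun p : ℕ × ℕ => a p.1 * conj (a p.2) *
      Complex.exp (-(Complex.I * t * (l p.1 - l p.2))))
      ((‖∑' n, a n * Complex.exp (-(Complex.I * t * l n))‖ ^ 2 : ℝ) : ℂ) := by
    intro t
    have h1 := summable_norm_mul_cexp ha l t
    have h2 : Summable fun n => ‖conj (a n * Complex.exp (-(Complex.I * t * l n)))‖ := by
      simpa only [RCLike.norm_conj] using h1
    have h3 := (summable_mul_of_summable_norm h1 h2).hasSum
    rw [← tsum_mul_tsum_of_summable_norm h1 h2, ← Complex.conj_tsum, Complex.mul_conj,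
      Complex.normSq_eq_norm_sq] at h3
    convert! h3 using 2 with p
    rw [map_mul, ← Complex.exp_conj]
    simp only [map_neg, map_mul, Complex.conj_I, Complex.conj_ofReal]
    rw [mul_mul_mul_comm, ← Complex.exp_add]
    congr 2
    ring
  convert! (key t).add (key (-t)) using 1
  · funext p
    rw [← mul_add]
    push_cast
    rw [Complex.two_cos]
    congr 1
    rw [add_comm]
    congr 2 <;> ring
  · push_cast
    rfl

/-- Integrated termwise, each pair (m, n) carries a nonnegative Fejér factor, so the double sums
compare term by term through Re(a_m conj a_n) ≤ b_m b_n. -/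
theorem integral_fejer_mul_normSq_le {a : ℕ → ℂ} {b : ℕ → ℝ} (hab : ∀ n, ‖a n‖ ≤ b n)
    (hb : Summable b) (l : ℕ → ℝ) :
    ∫ t in (0 : ℝ)..1, (1 - t) * (‖∑' n, a n * Complex.exp (-(Complex.I * t * l n))‖ ^ 2 +
        ‖∑' n, a n * Complex.exp (-(Complex.I * (-t : ℝ) * l n))‖ ^ 2) ≤
    ∫ t in (0 : ℝ)..1, (1 - t) * (‖∑' n, (b n : ℂ) * Complex.exp (-(Complex.I * t * l n))‖ ^ 2 +
        ‖∑' n, (b n : ℂ) * Complex.exp (-(Complex.I * (-t : ℝ) * l n))‖ ^ 2) := by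
  have key : ∀ c : ℕ → ℂ, (Summable fun n => ‖c n‖) → HasSum (fun p : ℕ × ℕ =>
      c p.1 * conj (c p.2) *
        ((∫ t in (0 : ℝ)..1, (1 - t) * (2 * Real.cos (t * (l p.1 - l p.2))) : ℝ) : ℂ))
      ((∫ t in (0 : ℝ)..1, (1 - t) * (‖∑' n, c n * Complex.exp (-(Complex.I * t * l n))‖ ^ 2 +
        ‖∑' n, c n * Complex.exp (-(Complex.I * (-t : ℝ) * l n))‖ ^ 2) : ℝ) : ℂ) := by
    intro c hc
    have h := intervalIntegral.hasSum_integral_of_dominated_convergence (μ := volume)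
      (a := (0 : ℝ)) (b := 1)
      (F := fun (p : ℕ × ℕ) (t : ℝ) => ((1 - t : ℝ) : ℂ) * (c p.1 * conj (c p.2) *
        ((2 * Real.cos (t * (l p.1 - l p.2)) : ℝ) : ℂ)))
      (f := fun t => ((1 - t : ℝ) : ℂ) *
        ((‖∑' n, c n * Complex.exp (-(Complex.I * t * l n))‖ ^ 2 +
        ‖∑' n, c n * Complex.exp (-(Complex.I * (-t : ℝ) * l n))‖ ^ 2 : ℝ) : ℂ))
      (bound := fun p _ => 2 * (‖c p.1‖ * ‖c p.2‖))
      (fun p => Continuous.aestronglyMeasurable (by fun_prop)) ?_ ?_ ?_ ?_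
    · convert! h using 1
      · funext p
        rw [← intervalIntegral.integral_ofReal, ← intervalIntegral.integral_const_mul]
        refine intervalIntegral.integral_congr fun t _ => ?_
        push_cast
        ring
      · rw [← intervalIntegral.integral_ofReal]
        refine intervalIntegral.integral_congr fun t _ => ?_
        push_cast
        rfl
    · intro p
      refine .of_forall fun t ht => ?_
      rw [Set.uIoc_of_le zero_le_one] at ht
      rw [norm_mul, norm_mul, norm_mul, RCLike.norm_conj, Complex.norm_real, Complex.norm_real,
        Real.norm_eq_abs, Real.norm_eq_abs, abs_mul]
      have h1 : |1 - t| ≤ 1 := abs_le.2 ⟨by linarith [ht.2], by linarith [ht.1]⟩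
      have h2 : |(2 : ℝ)| * |Real.cos (t * (l p.1 - l p.2))| ≤ 2 := by
        rw [abs_two]
        linarith [Real.abs_cos_le_one (t * (l p.1 - l p.2))]
      calc _ ≤ 1 * (‖c p.1‖ * ‖c p.2‖ * 2) := by gcongr
        _ = _ := by ring
    · exact .of_forall fun t _ => (summable_mul_of_summable_norm (f := fun n => ‖c n‖)
        (g := fun n => ‖c n‖) (by simpa using hc) (by simpa using hc)).mul_left 2
    · simp
    · refine .of_forall fun t _ => ?_
      exact (hasSum_normSq_add_normSq_neg hc l t).mul_left _
  have hb0 : ∀ n, 0 ≤ b n := fun n => (norm_nonneg _).trans (hab n)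
  have ha : Summable fun n => ‖a n‖ := hb.of_nonneg_of_le (fun n => norm_nonneg _) hab
  have hb' : Summable fun n => ‖(b n : ℂ)‖ := by
    simpa only [Complex.norm_real, Real.norm_eq_abs, abs_of_nonneg (hb0 _)] using hb
  have hA := Complex.hasSum_re (key a ha)
  have hB := Complex.hasSum_re (key _ hb')
  rw [Complex.ofReal_re] at hA hB
  refine hasSum_le (fun p => ?_) hA hB
  have hk := integral_triangle_mul_cos_nonneg (l p.1 - l p.2)
  rw [Complex.re_mul_ofReal, Complex.re_mul_ofReal]
  refine mul_le_mul_of_nonneg_right ?_ hk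
  calc _ ≤ ‖a p.1 * conj (a p.2)‖ := Complex.re_le_norm _
    _ = ‖a p.1‖ * ‖a p.2‖ := by rw [norm_mul, RCLike.norm_conj]
    _ ≤ b p.1 * b p.2 := mul_le_mul (hab _) (hab _) (norm_nonneg _) (hb0 _)
    _ = _ := by rw [Complex.conj_ofReal, ← Complex.ofReal_mul, Complex.ofReal_re]

/-- A majorant principle: over intervals of length one, the mean square of an absolutely convergent
exponential sum is controlled by that of the sum with majorizing nonnegative coefficients. -/
theorem integral_normSq_tsum_le_of_majorant {a : ℕ → ℂ} {b : ℕ → ℝ} (hab : ∀ n, ‖a n‖ ≤ b n)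
    (hb : Summable b) (l : ℕ → ℝ) (t₀ : ℝ) :
    ∫ t in (t₀ - 1 / 2)..(t₀ + 1 / 2), ‖∑' n, a n * Complex.exp (-(Complex.I * t * l n))‖ ^ 2 ≤
    2 * ∫ t in (-1 : ℝ)..1, ‖∑' n, (b n : ℂ) * Complex.exp (-(Complex.I * t * l n))‖ ^ 2 := by
  have hb0 : ∀ n, 0 ≤ b n := fun n => (norm_nonneg _).trans (hab n)
  have hb' : Summable fun n => ‖(b n : ℂ)‖ := by
    simpa only [Complex.norm_real, Real.norm_eq_abs, abs_of_nonneg (hb0 _)] using hb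
  -- Twisting the coefficients moves the interval to centre 0 without changing their absolute
  -- values.
  set c : ℕ → ℂ := fun n => a n * Complex.exp (-(Complex.I * t₀ * l n)) with hc
  have hcb : ∀ n, ‖c n‖ ≤ b n := fun n => by
    simpa only [hc, norm_mul, norm_cexp_neg_I_mul, mul_one] using hab n
  have hcs : Summable fun n => ‖c n‖ := hb.of_nonneg_of_le (fun n => norm_nonneg _) hcb
  have hsym : ∀ (g : ℝ → ℝ), Continuous g → ∀ r : ℝ,
      ∫ t in (-r)..r, g t = ∫ t in (0 : ℝ)..r, (g t + g (-t)) := by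
    intro g hg r
    have hg' : Continuous fun t => g (-t) := by fun_prop
    rw [intervalIntegral.integral_add (hg.intervalIntegrable _ _)
      (hg'.intervalIntegrable _ _), intervalIntegral.integral_comp_neg,
      neg_zero, add_comm, intervalIntegral.integral_add_adjacent_intervals
      (hg.intervalIntegrable _ _) (hg.intervalIntegrable _ _)]
  set A : ℝ → ℝ := fun t => ‖∑' n, c n * Complex.exp (-(Complex.I * t * l n))‖ ^ 2 with hA
  set B : ℝ → ℝ := fun t => ‖∑' n, (b n : ℂ) * Complex.exp (-(Complex.I * t * l n))‖ ^ 2 with hB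
  have hAc : Continuous A := (continuous_tsum_mul_cexp hcs l).norm.pow 2
  have hBc : Continuous B := (continuous_tsum_mul_cexp hb' l).norm.pow 2
  have hA0 : ∀ t, 0 ≤ A t := fun t => by positivity
  have hB0 : ∀ t, 0 ≤ B t := fun t => by positivity
  have e1 : ∫ t in (t₀ - 1 / 2)..(t₀ + 1 / 2),
      ‖∑' n, a n * Complex.exp (-(Complex.I * t * l n))‖ ^ 2 = ∫ t in (-(1 / 2 : ℝ))..(1 / 2), A t := by
    have := intervalIntegral.integral_comp_add_right (a := -(1 / 2 : ℝ)) (b := 1 / 2)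
      (fun t : ℝ => ‖∑' n, a n * Complex.exp (-(Complex.I * t * l n))‖ ^ 2) t₀
    rw [show t₀ - 1 / 2 = -(1 / 2) + t₀ by ring, show t₀ + 1 / 2 = 1 / 2 + t₀ by ring, ← this]
    refine intervalIntegral.integral_congr fun t _ => ?_
    simp only [hA, hc]
    congr 3
    funext n
    rw [mul_assoc (a n), ← Complex.exp_add]
    congr 2
    push_cast
    ring
  have hwA : Continuous fun t => (1 - t) * (A t + A (-t)) := by fun_prop
  calc _ = ∫ t in (0 : ℝ)..(1 / 2), (A t + A (-t)) := by rw [e1, hsym A hAc]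
    -- On [0, 1/2] one has 1 ≤ 2(1 - t), the source of the factor 2; after the comparison the weight
    -- is dropped again, being at most 1.
    _ ≤ ∫ t in (0 : ℝ)..(1 / 2), 2 * ((1 - t) * (A t + A (-t))) := by
        refine intervalIntegral.integral_mono_on (by norm_num)
          (Continuous.intervalIntegrable (by fun_prop) _ _)
          (Continuous.intervalIntegrable (by fun_prop) _ _) fun t ht => ?_
        nlinarith [hA0 t, hA0 (-t), ht.2, mul_nonneg (sub_nonneg.2 ht.2) (add_nonneg (hA0 t) (hA0 (-t)))]
    _ ≤ ∫ t in (0 : ℝ)..1, 2 * ((1 - t) * (A t + A (-t))) := by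
        rw [← intervalIntegral.integral_add_adjacent_intervals (a := (0 : ℝ)) (b := 1 / 2) (c := 1)
          (Continuous.intervalIntegrable (by fun_prop) _ _)
          (Continuous.intervalIntegrable (by fun_prop) _ _)]
        refine le_add_of_nonneg_right (intervalIntegral.integral_nonneg (by norm_num) fun t ht => ?_)
        have := hA0 t
        have := hA0 (-t)
        have := sub_nonneg.2 ht.2
        positivity
    _ = 2 * ∫ t in (0 : ℝ)..1, (1 - t) * (A t + A (-t)) := by
        rw [intervalIntegral.integral_const_mul]
    _ ≤ 2 * ∫ t in (0 : ℝ)..1, (1 - t) * (B t + B (-t)) := by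
        gcongr
        exact integral_fejer_mul_normSq_le hcb hb l
    _ ≤ 2 * ∫ t in (0 : ℝ)..1, (B t + B (-t)) := by
        gcongr
        refine intervalIntegral.integral_mono_on (by norm_num)
          (Continuous.intervalIntegrable (by fun_prop) _ _)
          (Continuous.intervalIntegrable (by fun_prop) _ _) fun t ht => ?_
        nlinarith [hB0 t, hB0 (-t), ht.1, mul_nonneg ht.1 (add_nonneg (hB0 t) (hB0 (-t)))]
    _ = _ := by rw [hsym B hBc]

end

/-! ### Mean squares of the Dirichlet series of Λ and fΛ. -/

section

open MeasureTheory ArithmeticFunction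

theorem integral_one_div_sq_add_sq_le {σ : ℝ} (hσ : 0 < σ) (a b : ℝ) :
    ∫ t in a..b, 1 / (σ ^ 2 + t ^ 2) ≤ Real.pi / σ := by
  have hd : ∀ t ∈ Set.uIcc a b, HasDerivAt (fun t : ℝ => Real.arctan (t / σ) / σ)
      (1 / (σ ^ 2 + t ^ 2)) t := by
    intro t _
    convert! (((hasDerivAt_id t).div_const σ).arctan).div_const σ using 1
    simp only [id]
    have : σ ^ 2 + t ^ 2 ≠ 0 := by positivity
    field_simp
  have hc : Continuous fun t : ℝ => 1 / (σ ^ 2 + t ^ 2) :=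
    continuous_const.div (by fun_prop) fun t => by positivity
  rw [intervalIntegral.integral_eq_sub_of_hasDerivAt hd (hc.intervalIntegrable _ _), ← sub_div]
  gcongr
  linarith [Real.arctan_lt_pi_div_two (b / σ), Real.neg_pi_div_two_lt_arctan (a / σ)]

theorem LSeries_term_add_I_mul (g : ℕ → ℂ) (s : ℂ) (t : ℝ) (n : ℕ) :
    LSeries.term g (s + Complex.I * t) n =
      LSeries.term g s n * Complex.exp (-(Complex.I * t * (Real.log n : ℝ))) := by
  rcases eq_or_ne n 0 with rfl | hn
  · simp
  have hn' : (n : ℂ) ≠ 0 := Nat.cast_ne_zero.2 hn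
  rw [LSeries.term_of_ne_zero hn, LSeries.term_of_ne_zero hn, Complex.cpow_add _ _ hn',
    Complex.exp_neg, Complex.cpow_def_of_ne_zero hn' (Complex.I * t), ← Complex.natCast_log,
    mul_comm ((Real.log n : ℝ) : ℂ), div_mul_eq_div_div, div_eq_mul_inv (g n / _)]

/-- The series of Λ minus 1/(s - 1) extends continuously to Re s ≥ 1, hence is bounded on the
compact rectangle [1,2] × [-1,1]. The extension is taken from the residue class modulo 1, which
contains every integer. -/
theorem exists_norm_LSeries_vonMangoldt_le :
    ∃ C : ℝ, 0 ≤ C ∧ ∀ σ t : ℝ, 0 < σ → σ ≤ 1 → |t| ≤ 1 →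
      ‖LSeries (fun n => (Λ n : ℂ)) (1 + σ + Complex.I * t)‖ ≤ C + 1 / ‖(σ + Complex.I * t : ℂ)‖ := by
  have hcont := vonMangoldt.continuousOn_LFunctionResidueClassAux (q := 1) 1
  have hcomp : IsCompact (Set.Icc (1 : ℝ) 2 ×ℂ Set.Icc (-1 : ℝ) 1) := isCompact_Icc.reProdIm isCompact_Icc
  obtain ⟨C, hC⟩ := hcomp.exists_bound_of_continuousOn
    (hcont.mono fun s hs => (Complex.mem_reProdIm.1 hs).1.1)
  refine ⟨max C 0, le_max_right _ _, fun σ t hσ hσ1 ht => ?_⟩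
  set s : ℂ := 1 + σ + Complex.I * t with hs
  have hre : s.re = 1 + σ := by simp [hs]
  have him : s.im = t := by simp [hs]
  have h1 := hC s (Complex.mem_reProdIm.2 ⟨⟨by linarith, by linarith⟩, by
    rw [him]; exact abs_le.1 ht⟩)
  have h2 := vonMangoldt.eqOn_LFunctionResidueClassAux (q := 1) (a := 1) isUnit_one
    (show s ∈ {s : ℂ | 1 < s.re} by simp only [Set.mem_ofPred_eq]; linarith)
  have h3 : (fun n => ((vonMangoldt.residueClass (1 : ZMod 1) n : ℝ) : ℂ)) =
      fun n => (Λ n : ℂ) := by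
    funext n
    rw [vonMangoldt.residueClass,
      Set.indicator_of_mem (s := {n : ℕ | (n : ZMod 1) = 1}) (Subsingleton.elim _ _)]
  simp only [h3, Nat.totient_one, Nat.cast_one, inv_one] at h2
  rw [h2] at h1
  have h4 : s - 1 = σ + Complex.I * t := by rw [hs]; ring
  calc _ = ‖(LSeries (fun n => (Λ n : ℂ)) s - 1 / (s - 1)) + 1 / (s - 1)‖ := by rw [sub_add_cancel]
    _ ≤ C + ‖1 / (s - 1)‖ := (norm_add_le _ _).trans (by gcongr)
    _ ≤ _ := by rw [norm_div, norm_one, h4]; gcongr; exact le_max_left _ _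

theorem exists_integral_norm_sq_LSeries_vonMangoldt_le :
    ∃ K : ℝ, 0 ≤ K ∧ ∀ σ : ℝ, 0 < σ → σ ≤ 1 →
      ∫ t in (-1 : ℝ)..1, ‖LSeries (fun n => (Λ n : ℂ)) (1 + σ + Complex.I * t)‖ ^ 2 ≤ K / σ := by
  obtain ⟨C, hC0, hC⟩ := exists_norm_LSeries_vonMangoldt_le
  refine ⟨4 * C ^ 2 + 2 * Real.pi, by positivity, fun σ hσ hσ1 => ?_⟩
  have hsum : LSeriesSummable (fun n => (Λ n : ℂ)) (1 + σ) :=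
    LSeriesSummable_vonMangoldt (by simpa using hσ)
  have hcont : Continuous fun t : ℝ => LSeries (fun n => (Λ n : ℂ)) (1 + σ + Complex.I * t) := by
    simp only [LSeries, LSeries_term_add_I_mul]
    exact continuous_tsum_mul_cexp hsum.norm _
  have hc : Continuous fun t : ℝ => 1 / (σ ^ 2 + t ^ 2) :=
    continuous_const.div (by fun_prop) fun t => by positivity
  calc _ ≤ ∫ t in (-1 : ℝ)..1, (2 * C ^ 2 + 2 * (1 / (σ ^ 2 + t ^ 2))) := by
        refine intervalIntegral.integral_mono_on (by norm_num)
          ((hcont.norm.pow 2).intervalIntegrable _ _)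
          (Continuous.intervalIntegrable (by fun_prop) _ _) fun t ht => ?_
        have h1 := hC σ t hσ hσ1 (abs_le.2 ht)
        have h2 : (1 / ‖(σ + Complex.I * t : ℂ)‖) ^ 2 = 1 / (σ ^ 2 + t ^ 2) := by
          rw [div_pow, one_pow, ← Complex.normSq_eq_norm_sq, Complex.normSq_apply]
          simp [sq]
        rw [← h2]
        refine (pow_le_pow_left₀ (norm_nonneg _) h1 2).trans ?_
        nlinarith [sq_nonneg (C - 1 / ‖(σ + Complex.I * t : ℂ)‖)]
    _ = 4 * C ^ 2 + 2 * ∫ t in (-1 : ℝ)..1, 1 / (σ ^ 2 + t ^ 2) := by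
        rw [intervalIntegral.integral_add (by simp) (Continuous.intervalIntegrable (by fun_prop) _ _),
          intervalIntegral.integral_const_mul, intervalIntegral.integral_const]
        norm_num
        ring
    _ ≤ 4 * C ^ 2 / σ + 2 * (Real.pi / σ) := by
        gcongr
        · rw [le_div_iff₀ hσ]
          nlinarith [sq_nonneg C]
        · exact integral_one_div_sq_add_sq_le hσ _ _
    _ = _ := by ring

/-- Since |fΛ| ≤ Λ, the majorant principle replaces any unit interval by [-1, 1] and f by 1; there
only the pole of -ζ'/ζ matters. The bound is therefore uniform in f and t₀. -/
theorem exists_integral_norm_sq_LSeries_mul_vonMangoldt_le :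
    ∃ K : ℝ, 0 ≤ K ∧ ∀ f : ℕ → ℂ, (∀ n, ‖f n‖ ≤ 1) → ∀ σ : ℝ, 0 < σ → σ ≤ 1 → ∀ t₀ : ℝ,
      ∫ t in (t₀ - 1 / 2)..(t₀ + 1 / 2),
        ‖LSeries (fun n => f n * (Λ n : ℂ)) (1 + σ + Complex.I * t)‖ ^ 2 ≤ K / σ := by
  obtain ⟨K, hK0, hK⟩ := exists_integral_norm_sq_LSeries_vonMangoldt_le
  refine ⟨2 * K, by positivity, fun f hf σ hσ hσ1 t₀ => ?_⟩
  have hsum : LSeriesSummable (fun n => (Λ n : ℂ)) (1 + σ) :=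
    LSeriesSummable_vonMangoldt (by simpa using hσ)
  have h := integral_normSq_tsum_le_of_majorant
    (a := fun n => LSeries.term (fun n => f n * (Λ n : ℂ)) (1 + σ) n)
    (b := fun n => ‖LSeries.term (fun n => (Λ n : ℂ)) (1 + σ) n‖)
    (fun n => LSeries.norm_term_le _ (by
      rw [norm_mul]; exact mul_le_of_le_one_left (norm_nonneg _) (hf n)))
    hsum.norm (fun n => Real.log n) t₀
  have hb : ∀ n, ((‖LSeries.term (fun n => (Λ n : ℂ)) (1 + σ) n‖ : ℝ) : ℂ) =
      LSeries.term (fun n => (Λ n : ℂ)) (1 + σ) n := by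
    intro n
    have := LSeries.term_nonneg (a := fun n => (Λ n : ℂ)) (n := n)
      (by exact_mod_cast vonMangoldt_nonneg) (1 + σ)
    push_cast at this
    rw [← Complex.norm_of_nonneg' this]
    simp
  simp only [hb, ← LSeries_term_add_I_mul] at h
  calc _ ≤ _ := h
    _ ≤ 2 * (K / σ) := by
      gcongr
      exact hK σ hσ hσ1
    _ = _ := by ring

end

/-! ### The Selberg sieve through Ramanujan sums, and Λ in short intervals. -/

section

open ArithmeticFunction

/-- Möbius inversion: for r = km the sum runs over the divisors of m and equals ∑_{d ∣ m} μ(d); it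
is empty when k does not divide r. -/
theorem sum_divisors_moebius_div_of_dvd {k r : ℕ} (hk : k ≠ 0) (hr : r ≠ 0) :
    ∑ d ∈ r.divisors, (if k ∣ d then (moebius (r / d) : ℝ) else 0) = if k = r then 1 else 0 := by
  have h1 : ∑ d ∈ r.divisors, (if k ∣ d then (moebius (r / d) : ℝ) else 0) =
      ∑ d ∈ r.divisors, (if k ∣ r / d then (moebius d : ℝ) else 0) := by
    rw [← Nat.sum_div_divisors]
    refine Finset.sum_congr rfl fun d hd => ?_
    rw [Nat.div_div_self (Nat.dvd_of_mem_divisors hd) hr]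
  rw [h1, ← Finset.sum_filter]
  by_cases hkr : k ∣ r
  · obtain ⟨m, rfl⟩ := hkr
    have hm : m ≠ 0 := by rintro rfl; simp at hr
    have h2 : (k * m).divisors.filter (fun d => k ∣ k * m / d) = m.divisors := by
      ext d
      simp only [Finset.mem_filter, Nat.mem_divisors]
      constructor
      · rintro ⟨⟨hd, _⟩, e, he⟩
        refine ⟨?_, hm⟩
        have h3 := Nat.div_mul_cancel hd
        rw [he, mul_assoc] at h3
        exact ⟨e, by rw [mul_comm d e]; exact (Nat.eq_of_mul_eq_mul_left (Nat.pos_of_ne_zero hk) h3).symm⟩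
      · rintro ⟨hd, _⟩
        exact ⟨⟨hd.mul_left k, hr⟩, by rw [Nat.mul_div_assoc _ hd]; exact dvd_mul_right _ _⟩
    rw [h2, ← Int.cast_sum, ← coe_mul_zeta_apply, moebius_mul_coe_zeta, one_apply]
    have : m = 1 ↔ k = k * m := by
      constructor
      · rintro rfl; simp
      · intro h
        exact Nat.eq_of_mul_eq_mul_left (Nat.pos_of_ne_zero hk) (by rw [mul_one]; exact h.symm)
    simp only [this]
    split_ifs <;> simp
  · rw [if_neg (by rintro rfl; exact hkr dvd_rfl), Finset.sum_eq_zero]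
    intro d hd
    rw [Finset.mem_filter] at hd
    exact absurd (hd.2.trans (Nat.div_dvd_of_dvd (Nat.dvd_of_mem_divisors hd.1))) hkr

/-- The expansion gcd(d, e) = ∑_{k ∣ d, k ∣ e} φ(k) separates the two sums, and Möbius inversion
leaves only k = r = s. This is the main term in the orthogonality of Ramanujan sums. -/
theorem sum_moebius_mul_moebius_mul_gcd {r s : ℕ} (hr : r ≠ 0) (hs : s ≠ 0) :
    ∑ d ∈ r.divisors, ∑ e ∈ s.divisors,
      (moebius (r / d) : ℝ) * moebius (s / e) * (d.gcd e : ℝ) =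
      if r = s then (r.totient : ℝ) else 0 := by
  have hg : ∀ d ∈ r.divisors, ∀ e : ℕ, (d.gcd e : ℝ) =
      ∑ k ∈ Finset.Icc 1 r, (k.totient : ℝ) * ((if k ∣ d then 1 else 0) * (if k ∣ e then 1 else 0)) := by
    intro d hd e
    have hd0 : d ≠ 0 := (Nat.pos_of_mem_divisors hd).ne'
    rw [← Nat.sum_totient (d.gcd e)]
    push_cast
    have : (d.gcd e).divisors = (Finset.Icc 1 r).filter (fun k => k ∣ d ∧ k ∣ e) := by
      ext k
      simp only [Nat.mem_divisors, Finset.mem_filter, Finset.mem_Icc, Nat.dvd_gcd_iff]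
      constructor
      · rintro ⟨⟨h1, h2⟩, _⟩
        exact ⟨⟨Nat.pos_of_ne_zero (by rintro rfl; exact hd0 (zero_dvd_iff.1 h1)),
          (Nat.le_of_dvd (Nat.pos_of_ne_zero hd0) h1).trans (Nat.divisor_le hd)⟩, h1, h2⟩
      · rintro ⟨_, h⟩
        exact ⟨h, Nat.gcd_ne_zero_left hd0⟩
    rw [this, Finset.sum_filter]
    refine Finset.sum_congr rfl fun k _ => ?_
    by_cases h1 : k ∣ d <;> by_cases h2 : k ∣ e <;> simp [h1, h2]
  calc _ = ∑ d ∈ r.divisors, ∑ e ∈ s.divisors, ∑ k ∈ Finset.Icc 1 r, (k.totient : ℝ) *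
        ((if k ∣ d then (moebius (r / d) : ℝ) else 0) *
          (if k ∣ e then (moebius (s / e) : ℝ) else 0)) := by
        refine Finset.sum_congr rfl fun d hd => Finset.sum_congr rfl fun e _ => ?_
        rw [hg d hd e, Finset.mul_sum]
        refine Finset.sum_congr rfl fun k _ => ?_
        by_cases h1 : k ∣ d <;> by_cases h2 : k ∣ e <;> simp [h1, h2]
        ring
    _ = ∑ k ∈ Finset.Icc 1 r, (k.totient : ℝ) *
        ((∑ d ∈ r.divisors, if k ∣ d then (moebius (r / d) : ℝ) else 0) *
          (∑ e ∈ s.divisors, if k ∣ e then (moebius (s / e) : ℝ) else 0)) := by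
        simp_rw [Finset.sum_mul_sum, Finset.mul_sum]
        rw [Finset.sum_comm]
        refine (Finset.sum_congr rfl fun e _ => Finset.sum_comm).trans ?_
        rw [Finset.sum_comm]
        exact Finset.sum_congr rfl fun k _ => Finset.sum_comm
    _ = ∑ k ∈ Finset.Icc 1 r, if k = r then (if r = s then (r.totient : ℝ) else 0) else 0 := by
        refine Finset.sum_congr rfl fun k hk => ?_
        have hk0 : k ≠ 0 := by have := (Finset.mem_Icc.1 hk).1; omega
        rw [sum_divisors_moebius_div_of_dvd hk0 hr, sum_divisors_moebius_div_of_dvd hk0 hs]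
        by_cases h : k = r
        · subst h; simp
        · simp [h]
    _ = _ := by
        rw [Finset.sum_ite_eq' (Finset.Icc 1 r) r, if_pos (Finset.mem_Icc.2 ⟨by omega, le_rfl⟩)]

/-- The Ramanujan sum `c_r(n)`. -/
noncomputable def ramanujanSum (r n : ℕ) : ℝ :=
  ∑ d ∈ r.divisors, if d ∣ n then (moebius (r / d) : ℝ) * d else 0

theorem abs_moebius_cast_le_one (n : ℕ) : |(moebius n : ℝ)| ≤ 1 := by
  exact_mod_cast abs_moebius_le_one

theorem abs_sum_Ioc_dvd_sub_le {a b m : ℕ} (hab : a ≤ b) (hm : m ≠ 0) :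
    |∑ n ∈ Finset.Ioc a b, (if m ∣ n then (1 : ℝ) else 0) - ((b : ℝ) - a) / m| ≤ 1 := by
  have h0 : ∀ c : ℕ, ∑ n ∈ Finset.Ioc 0 c, (if m ∣ n then (1 : ℝ) else 0) = ((c / m : ℕ) : ℝ) := by
    intro c
    rw [Finset.sum_boole, Nat.Ioc_filter_dvd_card_eq_div]
  have h1 : ∑ n ∈ Finset.Ioc a b, (if m ∣ n then (1 : ℝ) else 0) =
      ((b / m : ℕ) : ℝ) - ((a / m : ℕ) : ℝ) := by
    rw [← h0, ← h0, eq_sub_iff_add_eq, add_comm,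
      Finset.sum_Ioc_consecutive _ (Nat.zero_le _) hab]
  have hm0 : (0 : ℝ) < m := by exact_mod_cast Nat.pos_of_ne_zero hm
  have h2 : ∀ c : ℕ, ((c / m : ℕ) : ℝ) ≤ c / m ∧ (c : ℝ) / m < ((c / m : ℕ) : ℝ) + 1 := by
    intro c
    refine ⟨Nat.cast_div_le, ?_⟩
    rw [div_lt_iff₀ hm0]
    exact_mod_cast Nat.lt_mul_of_div_lt (Nat.lt_succ_self (c / m)) (Nat.pos_of_ne_zero hm) |>.trans_eq
      (by rw [Nat.succ_eq_add_one, mul_comm])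
  rw [h1, sub_div, abs_le]
  constructor <;> linarith [h2 a, h2 b, (h2 a).1, (h2 a).2, (h2 b).1, (h2 b).2]

theorem sum_divisors_cast_le {r R : ℕ} (hr : r ≤ R) : ∑ d ∈ r.divisors, (d : ℝ) ≤ (R : ℝ) ^ 2 := by
  calc ∑ d ∈ r.divisors, (d : ℝ) ≤ ∑ d ∈ r.divisors, (R : ℝ) :=
        Finset.sum_le_sum fun d hd => by exact_mod_cast (Nat.divisor_le hd).trans hr
    _ = r.divisors.card * (R : ℝ) := by rw [Finset.sum_const, nsmul_eq_mul]
    _ ≤ R * R := by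
        gcongr
        exact_mod_cast (Nat.card_divisors_le_self r).trans hr
    _ = _ := by ring

/-- Near-orthogonality on an interval: n divisible by both d and e is counted by (b - a)/lcm(d, e)
with error at most 1, and de/lcm(d, e) = gcd(d, e). The errors total at most (∑_{d ∣ r} d)(∑_{e ∣ s}
e) ≤ R⁴. -/
theorem abs_sum_ramanujanSum_mul_sub_le {a b r s R : ℕ} (hab : a ≤ b) (hr : r ≠ 0) (hs : s ≠ 0)
    (hrR : r ≤ R) (hsR : s ≤ R) :
    |∑ n ∈ Finset.Ioc a b, ramanujanSum r n * ramanujanSum s n -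
      ((b : ℝ) - a) * (if r = s then (r.totient : ℝ) else 0)| ≤ (R : ℝ) ^ 4 := by
  have e1 : ∑ n ∈ Finset.Ioc a b, ramanujanSum r n * ramanujanSum s n =
      ∑ d ∈ r.divisors, ∑ e ∈ s.divisors, (moebius (r / d) : ℝ) * moebius (s / e) * (d * e) *
        ∑ n ∈ Finset.Ioc a b, (if d.lcm e ∣ n then (1 : ℝ) else 0) := by
    simp_rw [ramanujanSum, Finset.sum_mul_sum, Finset.mul_sum]
    rw [Finset.sum_comm]
    refine Finset.sum_congr rfl fun d _ => ?_
    rw [Finset.sum_comm]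
    refine Finset.sum_congr rfl fun e _ => Finset.sum_congr rfl fun n _ => ?_
    by_cases h1 : d ∣ n <;> by_cases h2 : e ∣ n <;> simp [h1, h2, Nat.lcm_dvd_iff]
    ring
  rw [e1, ← sum_moebius_mul_moebius_mul_gcd hr hs, Finset.mul_sum, ← Finset.sum_sub_distrib]
  calc _ ≤ ∑ d ∈ r.divisors, ∑ e ∈ s.divisors, (d : ℝ) * e := by
        refine (Finset.abs_sum_le_sum_abs _ _).trans (Finset.sum_le_sum fun d hd => ?_)
        rw [Finset.mul_sum, ← Finset.sum_sub_distrib]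
        refine (Finset.abs_sum_le_sum_abs _ _).trans (Finset.sum_le_sum fun e he => ?_)
        have hd0 : d ≠ 0 := (Nat.pos_of_mem_divisors hd).ne'
        have he0 : e ≠ 0 := (Nat.pos_of_mem_divisors he).ne'
        have hl : d.lcm e ≠ 0 := Nat.lcm_ne_zero hd0 he0
        have hgl : (d.gcd e : ℝ) * (d.lcm e : ℝ) = d * e := by exact_mod_cast Nat.gcd_mul_lcm d e
        have hl' : (d.lcm e : ℝ) ≠ 0 := by exact_mod_cast hl
        have h3 : ((b : ℝ) - a) * ((moebius (r / d) : ℝ) * moebius (s / e) * (d.gcd e : ℝ)) =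
            (moebius (r / d) : ℝ) * moebius (s / e) * (d * e) * (((b : ℝ) - a) / (d.lcm e : ℕ)) := by
          rw [← hgl]
          field_simp
        rw [h3, ← mul_sub, abs_mul, abs_mul, abs_mul, abs_of_nonneg (by positivity : (0 : ℝ) ≤ d * e)]
        calc _ ≤ 1 * 1 * ((d : ℝ) * e) * 1 := by
              gcongr
              · exact abs_moebius_cast_le_one _
              · exact abs_moebius_cast_le_one _
              · exact abs_sum_Ioc_dvd_sub_le hab hl
          _ = _ := by ring
    _ = (∑ d ∈ r.divisors, (d : ℝ)) * ∑ e ∈ s.divisors, (e : ℝ) := by rw [Finset.sum_mul_sum]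
    _ ≤ (R : ℝ) ^ 2 * (R : ℝ) ^ 2 := by
        refine mul_le_mul (sum_divisors_cast_le hrR) (sum_divisors_cast_le hsR) ?_ (by positivity)
        exact Finset.sum_nonneg fun _ _ => Nat.cast_nonneg _
    _ = _ := by ring

/-- The sum `∑_{r ≤ R} μ(r)² / φ(r)`. -/
noncomputable def selbergSum (R : ℕ) : ℝ :=
  ∑ r ∈ Finset.Icc 1 R, (moebius r : ℝ) ^ 2 / r.totient

theorem one_le_selbergSum {R : ℕ} (hR : 1 ≤ R) : 1 ≤ selbergSum R := by
  have := Finset.single_le_sum (f := fun r : ℕ => (moebius r : ℝ) ^ 2 / r.totient)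
    (fun r _ => by positivity) (Finset.mem_Icc.2 ⟨le_rfl, hR⟩)
  simpa [selbergSum] using this

theorem sum_Icc_inv_sq_le (R : ℕ) : ∑ b ∈ Finset.Icc 1 R, 1 / (b : ℝ) ^ 2 ≤ 2 := by
  suffices h : ∑ b ∈ Finset.Icc 1 R, 1 / (b : ℝ) ^ 2 ≤ 2 - 1 / (R : ℝ) by
    have : (0 : ℝ) ≤ 1 / (R : ℝ) := by positivity
    linarith
  induction R with
  | zero => norm_num
  | succ n ih =>
    rcases Nat.eq_zero_or_pos n with rfl | hn
    · norm_num
    rw [Finset.sum_Icc_succ_top (by omega)]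
    have hn' : (0 : ℝ) < n := by exact_mod_cast hn
    have : 1 / ((n : ℝ) + 1) ^ 2 ≤ 1 / n - 1 / (n + 1) := by
      rw [div_sub_div _ _ (by positivity) (by positivity), div_le_div_iff₀ (by positivity)
        (by positivity)]
      nlinarith
    push_cast
    linarith

/-- Writing n = b²a with a squarefree bounds the harmonic sum by ∑ μ(a)²/a · ∑ 1/b²; then φ(a) ≤ a
and ∑ 1/b² ≤ 2. -/
theorem log_le_selbergSum (R : ℕ) : Real.log (R + 1) ≤ 2 * selbergSum R := by
  have h1 := log_add_one_le_harmonic R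
  rw [harmonic_eq_sum_Icc] at h1
  push_cast at h1
  refine h1.trans ?_
  calc ∑ n ∈ Finset.Icc 1 R, (n : ℝ)⁻¹ ≤
      ∑ n ∈ Finset.Icc 1 R, ∑ p ∈ Finset.Icc 1 R ×ˢ Finset.Icc 1 R,
        (if p.2 ^ 2 * p.1 = n then (moebius p.1 : ℝ) ^ 2 / p.1 * (1 / (p.2 : ℝ) ^ 2) else 0) := by
        refine Finset.sum_le_sum fun n hn => ?_
        obtain ⟨a, b, hab, hsq⟩ := Nat.sq_mul_squarefree n
        have hn1 := Finset.mem_Icc.1 hn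
        have ha : a ≠ 0 := by rintro rfl; simp at hab; omega
        have hb : b ≠ 0 := by rintro rfl; simp at hab; omega
        have hmem : (a, b) ∈ Finset.Icc 1 R ×ˢ Finset.Icc 1 R := by
          rw [Finset.mem_product, Finset.mem_Icc, Finset.mem_Icc]
          have h2 : a ∣ n := ⟨b ^ 2, by rw [← hab]; ring⟩
          have h3 : b ∣ n := ⟨b * a, by rw [← hab]; ring⟩
          have h4 := Nat.le_of_dvd (by omega) h2
          have h5 := Nat.le_of_dvd (by omega) h3
          refine ⟨⟨?_, ?_⟩, ?_, ?_⟩ <;> simp only <;> omega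
        have h6 := Finset.single_le_sum (f := fun p : ℕ × ℕ =>
          if p.2 ^ 2 * p.1 = n then (moebius p.1 : ℝ) ^ 2 / p.1 * (1 / (p.2 : ℝ) ^ 2) else 0)
          (fun p _ => by split_ifs <;> positivity) hmem
        refine le_trans (le_of_eq ?_) h6
        simp only [hab, if_true]
        have h7 : (moebius a : ℝ) ^ 2 = 1 := by
          exact_mod_cast moebius_sq_eq_one_of_squarefree hsq
        rw [h7, ← hab]
        push_cast
        have : (a : ℝ) ≠ 0 := by exact_mod_cast ha
        have : (b : ℝ) ≠ 0 := by exact_mod_cast hb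
        field_simp
    _ ≤ ∑ p ∈ Finset.Icc 1 R ×ˢ Finset.Icc 1 R,
        (moebius p.1 : ℝ) ^ 2 / p.1 * (1 / (p.2 : ℝ) ^ 2) := by
        rw [Finset.sum_comm]
        refine Finset.sum_le_sum fun p _ => ?_
        rw [Finset.sum_ite_eq]
        split_ifs
        · exact le_rfl
        · positivity
    _ = (∑ a ∈ Finset.Icc 1 R, (moebius a : ℝ) ^ 2 / a) * ∑ b ∈ Finset.Icc 1 R, 1 / (b : ℝ) ^ 2 := by
        rw [Finset.sum_mul_sum, Finset.sum_product]
    _ ≤ selbergSum R * 2 := by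
        refine mul_le_mul (Finset.sum_le_sum fun a ha => ?_) (sum_Icc_inv_sq_le R)
          (Finset.sum_nonneg fun _ _ => by positivity)
          (Finset.sum_nonneg fun _ _ => by positivity)
        have ha1 := (Finset.mem_Icc.1 ha).1
        have : 0 < a.totient := Nat.totient_pos.2 ha1
        gcongr
        exact Nat.totient_le a
    _ = _ := mul_comm _ _

/-- The Selberg sieve bound for the number of primes in an interval. -/
theorem card_primes_Ioc_mul_selbergSum_le {a b R : ℕ} (hab : a ≤ b) (hR : 1 ≤ R) :
    (((Finset.Ioc a b).filter fun n => n.Prime ∧ R < n).card : ℝ) * selbergSum R ≤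
      (b : ℝ) - a + (R : ℝ) ^ 6 := by
  -- These weights are constant on primes n > R: no divisor of r ≤ R other than 1 divides n, so
  -- c_r(n) = μ(r) and W(n) is the full Selberg sum. Near-orthogonality keeps the mean of W² as
  -- small as the Selberg sum itself, so one factor cancels.
  set W : ℕ → ℝ := fun n =>
    ∑ r ∈ Finset.Icc 1 R, (moebius r : ℝ) / r.totient * ramanujanSum r n with hW
  have hG1 := one_le_selbergSum hR
  have hprime : ∀ n, n.Prime → R < n → W n = selbergSum R := by
    intro n hn hRn
    refine Finset.sum_congr rfl fun r hr => ?_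
    have hr1 := Finset.mem_Icc.1 hr
    have h1 : ramanujanSum r n = moebius r := by
      rw [ramanujanSum, Finset.sum_eq_single 1]
      · simp
      · intro d hd hd1
        refine if_neg fun hdn => ?_
        rcases (Nat.dvd_prime hn).1 hdn with h | h
        · exact hd1 h
        · have := Nat.divisor_le hd
          omega
      · intro h
        exact absurd (Nat.one_mem_divisors.2 (by omega)) h
    rw [h1]
    ring
  have hlow : (((Finset.Ioc a b).filter fun n => n.Prime ∧ R < n).card : ℝ) * selbergSum R ^ 2 ≤
      ∑ n ∈ Finset.Ioc a b, W n ^ 2 := by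
    rw [← nsmul_eq_mul, ← Finset.sum_const]
    refine le_trans (le_of_eq ?_) (Finset.sum_le_sum_of_subset_of_nonneg
      (Finset.filter_subset (fun n => n.Prime ∧ R < n) _) fun n _ _ => sq_nonneg _)
    refine Finset.sum_congr rfl fun n hn => ?_
    have := (Finset.mem_filter.1 hn).2
    rw [hprime n this.1 this.2]
  have hup : ∑ n ∈ Finset.Ioc a b, W n ^ 2 ≤ ((b : ℝ) - a) * selbergSum R + (R : ℝ) ^ 6 := by
    have e1 : ∑ n ∈ Finset.Ioc a b, W n ^ 2 = ∑ r ∈ Finset.Icc 1 R, ∑ s ∈ Finset.Icc 1 R,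
        (moebius r : ℝ) / r.totient * ((moebius s : ℝ) / s.totient) *
          ∑ n ∈ Finset.Ioc a b, ramanujanSum r n * ramanujanSum s n := by
      simp_rw [hW, sq, Finset.sum_mul_sum, Finset.mul_sum]
      rw [Finset.sum_comm]
      refine Finset.sum_congr rfl fun r _ => ?_
      rw [Finset.sum_comm]
      refine Finset.sum_congr rfl fun s _ => Finset.sum_congr rfl fun n _ => ?_
      ring
    have e2 : ((b : ℝ) - a) * selbergSum R = ∑ r ∈ Finset.Icc 1 R, ∑ s ∈ Finset.Icc 1 R,
        (moebius r : ℝ) / r.totient * ((moebius s : ℝ) / s.totient) *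
          (((b : ℝ) - a) * (if r = s then (r.totient : ℝ) else 0)) := by
      rw [selbergSum, Finset.mul_sum]
      refine Finset.sum_congr rfl fun r hr => ?_
      rw [Finset.sum_eq_single r]
      · have : (r.totient : ℝ) ≠ 0 := by
          have := Nat.totient_pos.2 (Finset.mem_Icc.1 hr).1
          positivity
        rw [if_pos rfl]
        field_simp
      · intro s _ hs
        rw [if_neg hs.symm]
        simp
      · exact fun h => absurd hr h
    have hw : ∀ r ∈ Finset.Icc 1 R, |(moebius r : ℝ) / r.totient| ≤ 1 := by
      intro r hr
      have : (1 : ℝ) ≤ r.totient := by exact_mod_cast Nat.totient_pos.2 (Finset.mem_Icc.1 hr).1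
      rw [abs_div, Nat.abs_cast]
      exact div_le_one_of_le₀ ((abs_moebius_cast_le_one r).trans this) (by positivity)
    rw [← sub_le_iff_le_add', e1, e2, ← Finset.sum_sub_distrib]
    calc _ ≤ ∑ r ∈ Finset.Icc 1 R, ∑ s ∈ Finset.Icc 1 R, (R : ℝ) ^ 4 := by
          refine Finset.sum_le_sum fun r hr => ?_
          rw [← Finset.sum_sub_distrib]
          refine Finset.sum_le_sum fun s hs => ?_
          have hr1 := Finset.mem_Icc.1 hr
          have hs1 := Finset.mem_Icc.1 hs
          rw [← mul_sub]
          refine (le_abs_self _).trans ?_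
          rw [abs_mul, abs_mul]
          calc _ ≤ 1 * 1 * (R : ℝ) ^ 4 := by
                gcongr
                · exact hw r hr
                · exact hw s hs
                · exact abs_sum_ramanujanSum_mul_sub_le hab (by omega) (by omega) hr1.2 hs1.2
            _ = _ := by ring
      _ = _ := by
          simp only [Finset.sum_const, Nat.card_Icc, nsmul_eq_mul, Nat.add_sub_cancel]
          ring
  have h := hlow.trans hup
  have hG0 : 0 < selbergSum R := by linarith
  rw [← mul_le_mul_iff_left₀ hG0]
  calc _ = (((Finset.Ioc a b).filter fun n => n.Prime ∧ R < n).card : ℝ) * selbergSum R ^ 2 := by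
        ring
    _ ≤ _ := h
    _ ≤ _ := by
        rw [add_mul]
        gcongr
        exact le_mul_of_one_le_right (by positivity) hG1

/-- The sieve level R = ⌊z^(1/8)⌋ makes the error R⁶ at most z^(3/4), the order of the permitted
length. The constant is 92 = 80 + 4 + 8: primes above R (16 · (4 + 1)), integers up to R, and proper
prime powers. -/
theorem sum_vonMangoldt_Ioc_le {a b : ℕ} {z : ℝ} (hz : 1 ≤ z) (hab : a ≤ b) (hbz : (b : ℝ) ≤ z)
    (hlen : (b : ℝ) - a ≤ 4 * z ^ (3 / 4 : ℝ)) :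
    ∑ n ∈ Finset.Ioc a b, Λ n ≤ 92 * z ^ (3 / 4 : ℝ) := by
  have hz0 : (0 : ℝ) ≤ z := by linarith
  set R : ℕ := ⌊z ^ (1 / 8 : ℝ)⌋₊ with hR
  have hz8 : 1 ≤ z ^ (1 / 8 : ℝ) := Real.one_le_rpow hz (by norm_num)
  have hR1 : 1 ≤ R := Nat.le_floor (by exact_mod_cast hz8)
  have hRz : (R : ℝ) ≤ z ^ (1 / 8 : ℝ) := Nat.floor_le (by positivity)
  have hRz' : z ^ (1 / 8 : ℝ) < R + 1 := Nat.lt_floor_add_one _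
  have hlogz : 0 ≤ Real.log z := Real.log_nonneg hz
  have hlogR : Real.log z ≤ 8 * Real.log (R + 1) := by
    have := Real.log_le_log (by positivity) hRz'.le
    rw [Real.log_rpow (by linarith)] at this
    linarith
  have hbz' : b ≤ ⌊z⌋₊ := Nat.le_floor hbz
  set S := (Finset.Ioc a b).filter fun n => n.Prime ∧ R < n with hS
  have hR6 : (R : ℝ) ^ 6 ≤ z ^ (3 / 4 : ℝ) := by
    calc (R : ℝ) ^ 6 ≤ (z ^ (1 / 8 : ℝ)) ^ 6 := by gcongr
      _ = _ := by rw [← Real.rpow_natCast, ← Real.rpow_mul hz0]; norm_num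
  have h1 : (S.card : ℝ) * Real.log z ≤ 80 * z ^ (3 / 4 : ℝ) := by
    have h2 := card_primes_Ioc_mul_selbergSum_le hab hR1
    have h3 := log_le_selbergSum R
    calc (S.card : ℝ) * Real.log z ≤ S.card * (16 * selbergSum R) := by gcongr; linarith
      _ = 16 * (S.card * selbergSum R) := by ring
      _ ≤ 16 * ((b : ℝ) - a + (R : ℝ) ^ 6) := by gcongr
      _ ≤ _ := by linarith
  have h2 : (R : ℝ) * Real.log z ≤ 4 * z ^ (3 / 4 : ℝ) := by
    have h3 := Real.log_le_rpow_div hz0 (show (0 : ℝ) < 1 / 4 by norm_num)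
    calc (R : ℝ) * Real.log z ≤ z ^ (1 / 8 : ℝ) * (z ^ (1 / 4 : ℝ) / (1 / 4)) := by gcongr
      _ = 4 * z ^ (1 / 8 + 1 / 4 : ℝ) := by rw [Real.rpow_add (by linarith)]; ring
      _ ≤ _ := by
        gcongr
        · norm_num
  have h3 : Chebyshev.psi z - Chebyshev.theta z ≤ 8 * z ^ (3 / 4 : ℝ) := by
    have h3 := Real.log_le_rpow_div hz0 (show (0 : ℝ) < 1 / 4 by norm_num)
    refine (Chebyshev.psi_sub_theta_le hz).trans ?_
    rw [Real.sqrt_eq_rpow]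
    calc 2 * z ^ (1 / 2 : ℝ) * Real.log z ≤ 2 * z ^ (1 / 2 : ℝ) * (z ^ (1 / 4 : ℝ) / (1 / 4)) := by
          gcongr
      _ = 8 * z ^ (1 / 2 + 1 / 4 : ℝ) := by rw [Real.rpow_add (by linarith)]; ring
      _ = _ := by norm_num
  have hsplit : ∑ n ∈ Finset.Ioc a b, Λ n ≤ ∑ n ∈ S, Λ n +
      (∑ n ∈ Finset.Ioc 0 R, Real.log z + ∑ n ∈ Finset.Ioc 0 ⌊z⌋₊ with ¬ n.Prime, Λ n) := by
    rw [← Finset.sum_filter_add_sum_filter_not (Finset.Ioc a b) (fun n => n.Prime ∧ R < n)]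
    gcongr
    rw [← Finset.sum_filter_add_sum_filter_not ((Finset.Ioc a b).filter _) (fun n => n.Prime)]
    have hΛ : ∀ n ∈ Finset.Ioc a b, Λ n ≤ Real.log z := by
      intro n hn
      have := Finset.mem_Ioc.1 hn
      refine vonMangoldt_le_log.trans (Real.log_le_log (by exact_mod_cast (by omega : 0 < n)) ?_)
      exact le_trans (by exact_mod_cast this.2) hbz
    refine add_le_add ?_ ?_
    · refine (Finset.sum_le_sum fun n hn => hΛ n ?_).trans
        (Finset.sum_le_sum_of_subset_of_nonneg ?_ fun _ _ _ => hlogz)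
      · exact (Finset.mem_filter.1 (Finset.mem_filter.1 hn).1).1
      · intro n hn
        simp only [Finset.mem_filter, Finset.mem_Ioc, not_and, not_lt] at hn ⊢
        exact ⟨hn.2.pos, hn.1.2 hn.2⟩
    · refine Finset.sum_le_sum_of_subset_of_nonneg ?_ fun _ _ _ => vonMangoldt_nonneg
      intro n hn
      simp only [Finset.mem_filter, Finset.mem_Ioc] at hn ⊢
      exact ⟨⟨by omega, by omega⟩, hn.2⟩
  rw [← Chebyshev.psi_sub_theta_eq_sum_not_prime] at hsplit
  have h4 : ∑ n ∈ S, Λ n ≤ S.card * Real.log z := by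
    rw [← nsmul_eq_mul, ← Finset.sum_const]
    refine Finset.sum_le_sum fun n hn => ?_
    have := Finset.mem_Ioc.1 (Finset.mem_filter.1 hn).1
    refine vonMangoldt_le_log.trans (Real.log_le_log (by exact_mod_cast (by omega : 0 < n)) ?_)
    exact le_trans (by exact_mod_cast this.2) hbz
  simp only [Finset.sum_const, Nat.card_Ioc, nsmul_eq_mul, Nat.sub_zero] at hsplit
  linarith

end

/-! ### Logarithmic partial sums: from pointwise values to averages. -/

section

open MeasureTheory ArithmeticFunction

/-- The logarithmic partial sum `∑_{n ≤ e^v} f(n)/n`. -/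
noncomputable def logSum (f : ℕ → ℂ) (v : ℝ) : ℂ :=
  ∑ n ∈ Finset.Icc 1 ⌊Real.exp v⌋₊, f n / n

theorem logSum_of_neg (f : ℕ → ℂ) {v : ℝ} (hv : v < 0) : logSum f v = 0 := by
  have : ⌊Real.exp v⌋₊ = 0 := Nat.floor_eq_zero.2 (by simpa using hv)
  simp [logSum, this]

theorem measurable_logSum (f : ℕ → ℂ) : Measurable (logSum f) :=
  (measurable_of_countable fun N : ℕ => ∑ n ∈ Finset.Icc 1 N, f n / n).comp
    (Nat.measurable_floor.comp Real.measurable_exp)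

theorem norm_div_natCast_le {f : ℕ → ℂ} (hf : ∀ n, ‖f n‖ ≤ 1) (n : ℕ) :
    ‖f n / n‖ ≤ (n : ℝ)⁻¹ := by
  rw [norm_div, Complex.norm_natCast, div_eq_mul_inv]
  exact mul_le_of_le_one_left (by positivity) (hf n)

theorem norm_logSum_le {f : ℕ → ℂ} (hf : ∀ n, ‖f n‖ ≤ 1) {v : ℝ} (hv : 0 ≤ v) :
    ‖logSum f v‖ ≤ 1 + v := by
  have h1 : 1 ≤ ⌊Real.exp v⌋₊ := Nat.le_floor (by exact_mod_cast Real.one_le_exp hv)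
  calc ‖logSum f v‖ ≤ ∑ n ∈ Finset.Icc 1 ⌊Real.exp v⌋₊, (n : ℝ)⁻¹ :=
        norm_sum_le_of_le _ fun n _ => norm_div_natCast_le hf n
    _ = (harmonic ⌊Real.exp v⌋₊ : ℝ) := by
        rw [harmonic_eq_sum_Icc]
        push_cast
        rfl
    _ ≤ 1 + Real.log ⌊Real.exp v⌋₊ := harmonic_le_one_add_log _
    _ ≤ 1 + v := by
        gcongr
        rw [Real.log_le_iff_le_exp (by exact_mod_cast h1)]
        exact Nat.floor_le (Real.exp_pos v).le

theorem norm_logSum_le_max {f : ℕ → ℂ} (hf : ∀ n, ‖f n‖ ≤ 1) (v : ℝ) :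
    ‖logSum f v‖ ≤ 1 + max v 0 := by
  rcases lt_or_ge v 0 with hv | hv
  · rw [logSum_of_neg f hv, norm_zero]
    positivity
  · rw [max_eq_left hv]
    exact norm_logSum_le hf hv

theorem integrableOn_norm_logSum {f : ℕ → ℂ} (hf : ∀ n, ‖f n‖ ≤ 1) (a b : ℝ) :
    IntegrableOn (fun v => ‖logSum f v‖) (Set.Ioc a b) := by
  refine Measure.integrableOn_of_bounded (M := 1 + max b 0) (by simp)
    (measurable_logSum f).norm.aestronglyMeasurable ?_
  refine (ae_restrict_iff' measurableSet_Ioc).2 (.of_forall fun v hv => ?_)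
  rw [norm_norm]
  refine (norm_logSum_le_max hf v).trans ?_
  gcongr
  exact hv.2

theorem intervalIntegrable_norm_logSum {f : ℕ → ℂ} (hf : ∀ n, ‖f n‖ ≤ 1) (a b : ℝ) :
    IntervalIntegrable (fun v => ‖logSum f v‖) volume a b :=
  ⟨integrableOn_norm_logSum hf a b, integrableOn_norm_logSum hf b a⟩

/-- At most e^y - e^(y-w) + 1 integers lie in (e^(y-w), e^y], each contributing at most e^(w-y). The
term in e^(-y) pays for the jumps of the step function. -/
theorem norm_logSum_sub_logSum_le {f : ℕ → ℂ} (hf : ∀ n, ‖f n‖ ≤ 1) {y w : ℝ} (hw : 0 ≤ w)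
    (hw1 : w ≤ 1) : ‖logSum f y - logSum f (y - w)‖ ≤ 2 * w + 3 * Real.exp (-y) := by
  set u := Real.exp (y - w) with hu
  have hu0 : 0 < u := Real.exp_pos _
  have huy : u ≤ Real.exp y := Real.exp_le_exp.2 (by linarith)
  have hfl : ⌊u⌋₊ ≤ ⌊Real.exp y⌋₊ := Nat.floor_mono huy
  have e1 : logSum f y - logSum f (y - w) =
      ∑ n ∈ Finset.Ioc ⌊u⌋₊ ⌊Real.exp y⌋₊, f n / n := by
    rw [logSum, logSum, sub_eq_iff_eq_add, add_comm, ← hu,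
      show Finset.Icc 1 ⌊u⌋₊ = Finset.Ioc 0 ⌊u⌋₊ from rfl,
      show Finset.Icc 1 ⌊Real.exp y⌋₊ = Finset.Ioc 0 ⌊Real.exp y⌋₊ from rfl,
      Finset.sum_Ioc_consecutive _ (Nat.zero_le _) hfl]
  have h1 : ∀ n ∈ Finset.Ioc ⌊u⌋₊ ⌊Real.exp y⌋₊, ‖f n / n‖ ≤ u⁻¹ := by
    intro n hn
    refine (norm_div_natCast_le hf n).trans ?_
    gcongr
    exact ((Nat.floor_lt hu0.le).1 (Finset.mem_Ioc.1 hn).1).le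
  have hexp : Real.exp w ≤ 1 + 2 * w := by
    have := Real.abs_exp_sub_one_le (x := w) (by rwa [abs_of_nonneg hw])
    rw [abs_of_nonneg hw] at this
    linarith [le_abs_self (Real.exp w - 1)]
  have hinv : u⁻¹ = Real.exp w * Real.exp (-y) := by
    rw [hu, ← Real.exp_neg, ← Real.exp_add]
    congr 1
    ring
  have hcancel : Real.exp y * Real.exp (-y) = 1 := by rw [← Real.exp_add]; simp
  calc ‖logSum f y - logSum f (y - w)‖ ≤ ∑ n ∈ Finset.Ioc ⌊u⌋₊ ⌊Real.exp y⌋₊, u⁻¹ := by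
        rw [e1]
        exact norm_sum_le_of_le _ h1
    _ = ((⌊Real.exp y⌋₊ : ℝ) - ⌊u⌋₊) * u⁻¹ := by
        rw [Finset.sum_const, Nat.card_Ioc, nsmul_eq_mul, Nat.cast_sub hfl]
    _ ≤ (Real.exp y - (u - 1)) * u⁻¹ := by
        gcongr
        · exact Nat.floor_le (Real.exp_pos y).le
        · exact (Nat.sub_one_lt_floor u).le
    _ = Real.exp w - 1 + Real.exp w * Real.exp (-y) := by
        have : u * u⁻¹ = 1 := mul_inv_cancel₀ hu0.ne'
        rw [show (Real.exp y - (u - 1)) * u⁻¹ = Real.exp y * u⁻¹ - u * u⁻¹ + u⁻¹ by ring, this, hinv]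
        linear_combination Real.exp w * hcancel
    _ ≤ 2 * w + 3 * Real.exp (-y) := by
        have := Real.exp_pos (-y)
        gcongr
        · linarith
        · linarith

theorem integral_ite_le {c V : ℝ} (hc : 0 ≤ c) (hcV : c ≤ V) (z : ℂ) :
    ∫ v in (0 : ℝ)..V, (if c ≤ v then z else 0) = z * (V - c) := by
  have h1 : ∀ a b, IntervalIntegrable (fun v : ℝ => if c ≤ v then z else 0) volume a b := by
    intro a b
    have : (fun v : ℝ => if c ≤ v then z else 0) = (Set.Ici c).indicator fun _ => z := by
      funext v
      simp [Set.indicator_apply]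
    rw [this, intervalIntegrable_iff]
    exact IntegrableOn.indicator (by simp) measurableSet_Ici
  rw [← intervalIntegral.integral_add_adjacent_intervals (h1 0 c) (h1 c V)]
  have e1 : ∫ v in (0 : ℝ)..c, (if c ≤ v then z else 0) = 0 := by
    rw [intervalIntegral.integral_of_le hc, integral_Ioc_eq_integral_Ioo]
    refine setIntegral_eq_zero_of_forall_eq_zero fun v hv => ?_
    rw [if_neg (not_le.2 hv.2)]
  have e2 : ∫ v in c..V, (if c ≤ v then z else 0) = ∫ v in c..V, z := by
    refine intervalIntegral.integral_congr fun v hv => ?_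
    rw [Set.uIcc_of_le hcV] at hv
    simp only [if_pos hv.1]
  rw [e1, e2, intervalIntegral.integral_const, Complex.real_smul]
  push_cast
  ring

theorem log_natCast_le_iff {n : ℕ} (hn : 1 ≤ n) (v : ℝ) :
    Real.log n ≤ v ↔ n ≤ ⌊Real.exp v⌋₊ := by
  rw [Real.log_le_iff_le_exp (by exact_mod_cast hn), Nat.le_floor_iff (Real.exp_pos v).le]

theorem integral_logSum (f : ℕ → ℂ) {V : ℝ} (hV : 0 ≤ V) :
    ∫ v in (0 : ℝ)..V, logSum f v =
      ∑ n ∈ Finset.Icc 1 ⌊Real.exp V⌋₊, f n / n * (V - (Real.log n : ℝ)) := by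
  have h1 : ∫ v in (0 : ℝ)..V, logSum f v = ∫ v in (0 : ℝ)..V,
      ∑ n ∈ Finset.Icc 1 ⌊Real.exp V⌋₊, (if Real.log n ≤ v then f n / n else 0) := by
    refine intervalIntegral.integral_congr fun v hv => ?_
    rw [Set.uIcc_of_le hV] at hv
    simp only [logSum]
    rw [← Finset.sum_filter]
    refine Finset.sum_congr ?_ fun _ _ => rfl
    have hmono : ⌊Real.exp v⌋₊ ≤ ⌊Real.exp V⌋₊ := Nat.floor_mono (Real.exp_le_exp.2 hv.2)
    ext n
    rw [Finset.mem_filter, Finset.mem_Icc, Finset.mem_Icc]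
    constructor
    · rintro ⟨h1, h2⟩
      exact ⟨⟨h1, h2.trans hmono⟩, (log_natCast_le_iff h1 v).2 h2⟩
    · rintro ⟨⟨h1, _⟩, h2⟩
      exact ⟨h1, (log_natCast_le_iff h1 v).1 h2⟩
  rw [h1, intervalIntegral.integral_finsetSum]
  · refine Finset.sum_congr rfl fun n hn => ?_
    have hn := Finset.mem_Icc.1 hn
    exact integral_ite_le (Real.log_natCast_nonneg n) ((log_natCast_le_iff hn.1 V).2 hn.2) _
  · intro n _
    have : (fun v : ℝ => if Real.log n ≤ v then f n / (n : ℂ) else 0) =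
        (Set.Ici (Real.log n)).indicator fun _ => f n / (n : ℂ) := by
      funext v
      simp [Set.indicator_apply]
    rw [this, intervalIntegrable_iff]
    exact IntegrableOn.indicator (by simp) measurableSet_Ici

theorem logSum_sub_log (f : ℕ → ℂ) (V : ℝ) {d : ℕ} (hd : d ≠ 0) :
    logSum f (V - Real.log d) = ∑ m ∈ Finset.Ioc 0 (⌊Real.exp V⌋₊ / d), f m / m := by
  rw [logSum, Real.exp_sub, Real.exp_log (by exact_mod_cast Nat.pos_of_ne_zero hd),
    Nat.floor_div_natCast]
  rfl

/-- From log = Λ * 1 and complete multiplicativity, f·log = (fΛ) * f; the sum is then regrouped by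
the Λ-variable d. -/
theorem sum_div_mul_log_eq (f : ℕ →*₀ ℂ) (V : ℝ) :
    ∑ n ∈ Finset.Icc 1 ⌊Real.exp V⌋₊, f n / n * (Real.log n : ℝ) =
      ∑ d ∈ Finset.Icc 1 ⌊Real.exp V⌋₊, f d * (Λ d : ℂ) / d * logSum f (V - Real.log d) := by
  obtain ⟨g, hg⟩ : ∃ g : ArithmeticFunction ℂ, ∀ n, g n = f n * (Λ n : ℂ) / n :=
    ⟨⟨fun n => f n * (Λ n : ℂ) / n, by simp⟩, fun _ => rfl⟩
  obtain ⟨k, hk⟩ : ∃ k : ArithmeticFunction ℂ, ∀ n, k n = f n / n :=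
    ⟨⟨fun n => f n / n, by simp⟩, fun _ => rfl⟩
  have h := sum_Ioc_mul_eq_sum_sum g k ⌊Real.exp V⌋₊
  have h2 : ∑ d ∈ Finset.Icc 1 ⌊Real.exp V⌋₊, f d * (Λ d : ℂ) / d * logSum f (V - Real.log d) =
      ∑ d ∈ Finset.Ioc 0 ⌊Real.exp V⌋₊, f d * (Λ d : ℂ) / d *
        ∑ m ∈ Finset.Ioc 0 (⌊Real.exp V⌋₊ / d), f m / m := by
    refine Finset.sum_congr rfl fun d hd => ?_
    rw [logSum_sub_log]
    have := (Finset.mem_Icc.1 hd).1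
    omega
  simp only [← hg, ← hk] at h2 ⊢
  rw [h2, ← h]
  refine Finset.sum_congr rfl fun n hn => ?_
  have hn0 : n ≠ 0 := by have := (Finset.mem_Icc.1 hn).1; omega
  rw [mul_apply, hk, ← vonMangoldt_sum, ← Nat.sum_divisorsAntidiagonal (fun i _ => Λ i)]
  push_cast
  rw [Finset.mul_sum]
  refine Finset.sum_congr rfl fun p hp => ?_
  obtain ⟨hp1, _⟩ := Nat.mem_divisorsAntidiagonal.1 hp
  rw [← hp1, map_mul, hg, hk]
  push_cast
  ring

/-- Split V = (V - log n) + log n under the sum: the first part is the integral of `logSum`, the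
second the convolution with fΛ. -/
theorem norm_logSum_mul_le (f : ℕ →*₀ ℂ) (hf : ∀ n : ℕ, ‖f n‖ ≤ 1) {V : ℝ} (hV : 0 ≤ V) :
    ‖logSum (fun n => f n) V‖ * V ≤ (∫ v in (0 : ℝ)..V, ‖logSum (fun n => f n) v‖) +
      ∑ d ∈ Finset.Icc 1 ⌊Real.exp V⌋₊, Λ d / d * ‖logSum (fun n => f n) (V - Real.log d)‖ := by
  have h1 : logSum (fun n => f n) V * V = (∫ v in (0 : ℝ)..V, logSum (fun n => f n) v) +
      ∑ d ∈ Finset.Icc 1 ⌊Real.exp V⌋₊, f d * (Λ d : ℂ) / d *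
        logSum (fun n => f n) (V - Real.log d) := by
    rw [integral_logSum _ hV, ← sum_div_mul_log_eq, ← Finset.sum_add_distrib, logSum,
      Finset.sum_mul]
    exact Finset.sum_congr rfl fun n _ => by ring
  have h2 : ‖logSum (fun n => f n) V‖ * V = ‖logSum (fun n => f n) V * V‖ := by
    rw [norm_mul, Complex.norm_real, Real.norm_of_nonneg hV]
  rw [h2, h1]
  refine (norm_add_le _ _).trans (add_le_add ?_ ?_)
  · exact intervalIntegral.norm_integral_le_integral_norm hV
  · refine norm_sum_le_of_le _ fun d _ => ?_
    rw [norm_mul, norm_div, norm_mul, Complex.norm_natCast, Complex.norm_real,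
      Real.norm_of_nonneg vonMangoldt_nonneg]
    gcongr
    exact mul_le_of_le_one_left vonMangoldt_nonneg (hf d)

/-- Bounded overlap of the windows. With z = e^y, the admissible d fill an interval of length
O(z^(3/4)) ending at z, where the weight is at most 3z^(-3/4); the sieve bound 92z^(3/4) then gives
276. -/
theorem sum_vonMangoldt_window_le {y : ℝ} (hy : 0 ≤ y) (N : ℕ) :
    ∑ d ∈ Finset.Icc 1 N, (if y - (d : ℝ) ^ (-(1 / 4) : ℝ) ≤ Real.log d ∧ Real.log d ≤ y then
      Λ d * (d : ℝ) ^ (-(3 / 4) : ℝ) else 0) ≤ 276 := by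
  set z := Real.exp y with hz
  have hz1 : 1 ≤ z := Real.one_le_exp hy
  have hz0 : 0 < z := Real.exp_pos y
  -- Since d ≥ z/3, the window length d^(-1/4) is at most 3^(1/4)z^(-1/4) ≤ 2z^(-1/4), so d ≥ z -
  -- 2z^(3/4); the extra -1 makes a < d strict. A negative argument simply gives a = 0.
  set a := ⌊z - 2 * z ^ (3 / 4 : ℝ) - 1⌋₊ with ha
  have hpow : 1 ≤ z ^ (3 / 4 : ℝ) := Real.one_le_rpow hz1 (by norm_num)
  have hab : a ≤ ⌊z⌋₊ := Nat.floor_mono (by linarith)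
  have hlen : ((⌊z⌋₊ : ℕ) : ℝ) - a ≤ 4 * z ^ (3 / 4 : ℝ) := by
    have h1 := Nat.floor_le hz0.le
    have h2 := Nat.sub_one_lt_floor (z - 2 * z ^ (3 / 4 : ℝ) - 1)
    rw [← ha] at h2
    linarith
  have hmain := sum_vonMangoldt_Ioc_le hz1 hab (Nat.floor_le hz0.le) hlen
  have he3 : Real.exp 1 < 3 := Real.exp_one_lt_three
  have key : ∀ d : ℕ, 1 ≤ d → y - (d : ℝ) ^ (-(1 / 4) : ℝ) ≤ Real.log d → Real.log d ≤ y →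
      d ∈ Finset.Ioc a ⌊z⌋₊ ∧ (d : ℝ) ^ (-(3 / 4) : ℝ) ≤ 3 * z ^ (-(3 / 4) : ℝ) := by
    intro d hd h1 h2
    have hd0 : (0 : ℝ) < d := by exact_mod_cast hd
    have hd1 : (1 : ℝ) ≤ d := by exact_mod_cast hd
    have hδ1 : (d : ℝ) ^ (-(1 / 4) : ℝ) ≤ 1 := Real.rpow_le_one_of_one_le_of_nonpos hd1 (by norm_num)
    have h3 : z * Real.exp (-(d : ℝ) ^ (-(1 / 4) : ℝ)) ≤ d := by
      rw [hz, ← Real.exp_add, ← Real.exp_log hd0]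
      refine Real.exp_le_exp.2 ?_
      rw [Real.exp_log hd0]
      linarith
    have h4 : z / 3 ≤ d := by
      refine le_trans ?_ h3
      rw [div_eq_mul_inv]
      gcongr
      calc (3 : ℝ)⁻¹ ≤ (Real.exp 1)⁻¹ := by gcongr
        _ = Real.exp (-1) := by rw [Real.exp_neg]
        _ ≤ _ := Real.exp_le_exp.2 (by linarith)
    have hz3 : 0 < z / 3 := by positivity
    have hr : ∀ e : ℝ, 0 ≤ e → e ≤ 1 → (d : ℝ) ^ (-e) ≤ 3 ^ e * z ^ (-e) := by
      intro e he0 he1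
      calc (d : ℝ) ^ (-e) ≤ (z / 3) ^ (-e) := Real.rpow_le_rpow_of_nonpos hz3 h4 (by linarith)
        _ = _ := by
          rw [Real.div_rpow hz0.le (by norm_num), Real.rpow_neg (by norm_num : (0 : ℝ) ≤ 3)]
          field_simp
    refine ⟨?_, ?_⟩
    · rw [Finset.mem_Ioc]
      refine ⟨?_, ?_⟩
      · have h5 : (d : ℝ) ^ (-(1 / 4) : ℝ) ≤ 2 * z ^ (-(1 / 4) : ℝ) := by
          refine (hr (1 / 4) (by norm_num) (by norm_num)).trans ?_
          gcongr
          calc (3 : ℝ) ^ (1 / 4 : ℝ) ≤ (16 : ℝ) ^ (1 / 4 : ℝ) := by gcongr; norm_num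
            _ = 2 := by
              rw [show (16 : ℝ) = 2 ^ (4 : ℝ) by norm_num, ← Real.rpow_mul (by norm_num)]
              norm_num
        have h6 : z * (1 - 2 * z ^ (-(1 / 4) : ℝ)) ≤ d := by
          refine le_trans ?_ h3
          gcongr
          have := Real.add_one_le_exp (-(d : ℝ) ^ (-(1 / 4) : ℝ))
          linarith
        have h7 : z * z ^ (-(1 / 4) : ℝ) = z ^ (3 / 4 : ℝ) := by
          nth_rewrite 1 [← Real.rpow_one z]
          rw [← Real.rpow_add hz0]
          norm_num
        refine (Nat.floor_lt' (by omega)).2 ?_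
        have h8 : z * (1 - 2 * z ^ (-(1 / 4) : ℝ)) = z - 2 * z ^ (3 / 4 : ℝ) := by
          rw [← h7]; ring
        linarith
      · exact (log_natCast_le_iff hd y).1 h2
    · refine (hr (3 / 4) (by norm_num) (by norm_num)).trans ?_
      gcongr
      calc (3 : ℝ) ^ (3 / 4 : ℝ) ≤ 3 ^ (1 : ℝ) := by gcongr <;> norm_num
        _ = 3 := Real.rpow_one 3
  calc _ ≤ ∑ d ∈ (Finset.Icc 1 N).filter (fun d : ℕ => y - (d : ℝ) ^ (-(1 / 4) : ℝ) ≤ Real.log d ∧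
        Real.log d ≤ y), Λ d * (3 * z ^ (-(3 / 4) : ℝ)) := by
        rw [← Finset.sum_filter]
        refine Finset.sum_le_sum fun d hd => ?_
        rw [Finset.mem_filter, Finset.mem_Icc] at hd
        gcongr
        exact (key d hd.1.1 hd.2.1 hd.2.2).2
    _ ≤ ∑ d ∈ Finset.Ioc a ⌊z⌋₊, Λ d * (3 * z ^ (-(3 / 4) : ℝ)) := by
        refine Finset.sum_le_sum_of_subset_of_nonneg (fun d hd => ?_) fun d _ _ => by positivity
        rw [Finset.mem_filter, Finset.mem_Icc] at hd
        exact (key d hd.1.1 hd.2.1 hd.2.2).1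
    _ ≤ (92 * z ^ (3 / 4 : ℝ)) * (3 * z ^ (-(3 / 4) : ℝ)) := by
        rw [← Finset.sum_mul]
        gcongr
    _ = 276 := by
        rw [Real.rpow_neg hz0.le]
        field_simp
        norm_num

theorem mul_norm_logSum_le_integral_window {f : ℕ → ℂ} (hf : ∀ n, ‖f n‖ ≤ 1) {y w : ℝ}
    (hw : 0 ≤ w) (hw1 : w ≤ 1) :
    w * ‖logSum f y‖ ≤ (∫ v in (y - w)..y, ‖logSum f v‖) + w * (2 * w + 3 * Real.exp (-y)) := by
  have h1 : ∀ v ∈ Set.Icc (y - w) y, ‖logSum f y‖ - (2 * w + 3 * Real.exp (-y)) ≤ ‖logSum f v‖ := by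
    intro v hv
    have h2 := norm_logSum_sub_logSum_le hf (y := y) (w := y - v) (by linarith [hv.2])
      (by linarith [hv.1])
    rw [sub_sub_cancel] at h2
    have h3 := norm_sub_norm_le (logSum f y) (logSum f v)
    have := hv.1
    linarith
  have h2 := intervalIntegral.integral_mono_on (a := y - w) (b := y) (by linarith)
    (intervalIntegrable_const) (intervalIntegrable_norm_logSum hf _ _) h1
  rw [intervalIntegral.integral_const, smul_eq_mul, sub_sub_cancel] at h2
  linarith

/-- Interchange sum and integral: the weight received by a given v is the window sum with y = V - v.
-/
theorem sum_mul_integral_window_le {f : ℕ → ℂ} (hf : ∀ n, ‖f n‖ ≤ 1) {V : ℝ} (hV : 0 ≤ V) :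
    ∑ d ∈ Finset.Icc 1 ⌊Real.exp V⌋₊, Λ d * (d : ℝ) ^ (-(3 / 4) : ℝ) *
      ∫ v in (V - Real.log d - (d : ℝ) ^ (-(1 / 4) : ℝ))..(V - Real.log d), ‖logSum f v‖ ≤
    276 * ∫ v in (0 : ℝ)..V, ‖logSum f v‖ := by
  -- Windows can reach below 0 by at most 1, where the partial sum vanishes.
  have h0 : ∫ v in (-1 : ℝ)..V, ‖logSum f v‖ = ∫ v in (0 : ℝ)..V, ‖logSum f v‖ := by
    rw [← intervalIntegral.integral_add_adjacent_intervals (b := 0)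
      (intervalIntegrable_norm_logSum hf _ _) (intervalIntegrable_norm_logSum hf _ _)]
    have : ∫ v in (-1 : ℝ)..0, ‖logSum f v‖ = 0 := by
      rw [intervalIntegral.integral_of_le (by norm_num), integral_Ioc_eq_integral_Ioo]
      refine setIntegral_eq_zero_of_forall_eq_zero fun v hv => ?_
      rw [logSum_of_neg f hv.2, norm_zero]
    rw [this, zero_add]
  set I : ℕ → Set ℝ := fun d =>
    Set.Ioc (V - Real.log d - (d : ℝ) ^ (-(1 / 4) : ℝ)) (V - Real.log d) with hI
  have h1 : ∀ d ∈ Finset.Icc 1 ⌊Real.exp V⌋₊,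
      ∫ v in (V - Real.log d - (d : ℝ) ^ (-(1 / 4) : ℝ))..(V - Real.log d), ‖logSum f v‖ =
      ∫ v in Set.Ioc (-1 : ℝ) V, (I d).indicator (fun v => ‖logSum f v‖) v := by
    intro d hd
    have hd := Finset.mem_Icc.1 hd
    have hd1 : (1 : ℝ) ≤ d := by exact_mod_cast hd.1
    have hδ1 : (d : ℝ) ^ (-(1 / 4) : ℝ) ≤ 1 := Real.rpow_le_one_of_one_le_of_nonpos hd1 (by norm_num)
    have hδ0 : 0 ≤ (d : ℝ) ^ (-(1 / 4) : ℝ) := by positivity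
    have hl := (log_natCast_le_iff hd.1 V).2 hd.2
    have hl0 := Real.log_natCast_nonneg d
    rw [intervalIntegral.integral_of_le (by linarith), setIntegral_indicator measurableSet_Ioc,
      Set.inter_eq_self_of_subset_right]
    exact Set.Ioc_subset_Ioc (by linarith) (by linarith)
  have hint : ∀ d : ℕ, IntegrableOn (fun v => Λ d * (d : ℝ) ^ (-(3 / 4) : ℝ) *
      (I d).indicator (fun v => ‖logSum f v‖) v) (Set.Ioc (-1 : ℝ) V) := fun d =>
    ((integrableOn_norm_logSum hf _ _).indicator measurableSet_Ioc).const_mul _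
  calc _ = ∑ d ∈ Finset.Icc 1 ⌊Real.exp V⌋₊, ∫ v in Set.Ioc (-1 : ℝ) V,
        Λ d * (d : ℝ) ^ (-(3 / 4) : ℝ) * (I d).indicator (fun v => ‖logSum f v‖) v := by
        refine Finset.sum_congr rfl fun d hd => ?_
        rw [h1 d hd, integral_const_mul]
    _ = ∫ v in Set.Ioc (-1 : ℝ) V, ∑ d ∈ Finset.Icc 1 ⌊Real.exp V⌋₊,
        Λ d * (d : ℝ) ^ (-(3 / 4) : ℝ) * (I d).indicator (fun v => ‖logSum f v‖) v := by
        rw [integral_finsetSum _ fun d _ => hint d]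
    _ ≤ ∫ v in Set.Ioc (-1 : ℝ) V, 276 * ‖logSum f v‖ := by
        refine setIntegral_mono_on (integrable_finsetSum _ fun d _ => hint d)
          ((integrableOn_norm_logSum hf _ _).const_mul _) measurableSet_Ioc fun v hv => ?_
        refine le_trans ?_ (mul_le_mul_of_nonneg_right (sum_vonMangoldt_window_le
          (y := V - v) (by linarith [hv.2]) ⌊Real.exp V⌋₊) (norm_nonneg (logSum f v)))
        rw [Finset.sum_mul]
        refine Finset.sum_le_sum fun d _ => ?_
        by_cases hvd : v ∈ I d
        · rw [Set.indicator_of_mem hvd, if_pos ⟨by linarith [hvd.1], by linarith [hvd.2]⟩]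
        · rw [Set.indicator_of_notMem hvd, mul_zero]
          split_ifs <;> positivity
    _ = _ := by rw [integral_const_mul, ← intervalIntegral.integral_of_le (by linarith), h0]

/-- Factor 1/d = d^(-3/4) · d^(-1/4) as weight times window length and average over each window. The
variation of s costs the convergent ∑ Λ(d)d^(-5/4), and the jumps cost e^(-V)ψ(e^V), bounded by
Chebyshev. -/
theorem exists_norm_logSum_mul_le :
    ∃ C : ℝ, 0 ≤ C ∧ ∀ f : ℕ →*₀ ℂ, (∀ n : ℕ, ‖f n‖ ≤ 1) → ∀ V : ℝ, 0 ≤ V →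
      ‖logSum (fun n => f n) V‖ * V ≤ C * (1 + ∫ v in (0 : ℝ)..V, ‖logSum (fun n => f n) v‖) := by
  have hsum : Summable fun n : ℕ => Λ n / (n : ℝ) ^ (5 / 4 : ℝ) := by
    have h := (LSeriesSummable_vonMangoldt (s := (5 / 4 : ℝ)) (by norm_num)).norm
    refine h.congr fun n => ?_
    rw [LSeries.norm_term_eq]
    rcases eq_or_ne n 0 with rfl | hn
    · simp
    · rw [if_neg hn, Complex.norm_real, Real.norm_of_nonneg vonMangoldt_nonneg, Complex.ofReal_re]
  set A := ∑' n : ℕ, Λ n / (n : ℝ) ^ (5 / 4 : ℝ) with hA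
  have hA0 : 0 ≤ A := tsum_nonneg fun n => div_nonneg vonMangoldt_nonneg (by positivity)
  set B := Real.log 4 + 4 with hB
  have hB0 : 0 ≤ B := by have := Real.log_nonneg (show (1 : ℝ) ≤ 4 by norm_num); positivity
  refine ⟨277 + 2 * A + 3 * B, by positivity, fun f hf V hV => ?_⟩
  set s := logSum (fun n => f n) with hs
  set J := ∫ v in (0 : ℝ)..V, ‖s v‖ with hJ
  have hJ0 : 0 ≤ J := intervalIntegral.integral_nonneg hV fun v _ => norm_nonneg _
  have hterm : ∀ d ∈ Finset.Icc 1 ⌊Real.exp V⌋₊, Λ d / d * ‖s (V - Real.log d)‖ ≤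
      Λ d * (d : ℝ) ^ (-(3 / 4) : ℝ) *
        (∫ v in (V - Real.log d - (d : ℝ) ^ (-(1 / 4) : ℝ))..(V - Real.log d), ‖s v‖) +
      (2 * (Λ d / (d : ℝ) ^ (5 / 4 : ℝ)) + 3 * Real.exp (-V) * Λ d) := by
    intro d hd
    have hd := Finset.mem_Icc.1 hd
    have hd1 : (1 : ℝ) ≤ d := by exact_mod_cast hd.1
    have hd0 : (0 : ℝ) < d := by linarith
    have hδ1 : (d : ℝ) ^ (-(1 / 4) : ℝ) ≤ 1 := Real.rpow_le_one_of_one_le_of_nonpos hd1 (by norm_num)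
    have hδ0 : 0 ≤ (d : ℝ) ^ (-(1 / 4) : ℝ) := by positivity
    have h1 := mul_norm_logSum_le_integral_window (f := fun n => f n) hf
      (y := V - Real.log d) hδ0 hδ1
    have hexp : Real.exp (-(V - Real.log d)) = Real.exp (-V) * d := by
      rw [neg_sub, sub_eq_neg_add, Real.exp_add, Real.exp_log hd0]
    rw [hexp] at h1
    have e1 : (d : ℝ)⁻¹ = (d : ℝ) ^ (-(3 / 4) : ℝ) * (d : ℝ) ^ (-(1 / 4) : ℝ) := by
      rw [← Real.rpow_add hd0, ← Real.rpow_neg_one]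
      norm_num
    have e2 : 1 / (d : ℝ) ^ (5 / 4 : ℝ) =
        (d : ℝ) ^ (-(3 / 4) : ℝ) * (d : ℝ) ^ (-(1 / 4) : ℝ) * (d : ℝ) ^ (-(1 / 4) : ℝ) := by
      rw [← Real.rpow_add hd0, ← Real.rpow_add hd0, one_div, ← Real.rpow_neg hd0.le]
      norm_num
    have hΛ : 0 ≤ Λ d * (d : ℝ) ^ (-(3 / 4) : ℝ) := mul_nonneg vonMangoldt_nonneg (by positivity)
    have h2 := mul_le_mul_of_nonneg_left h1 hΛ
    calc Λ d / d * ‖s (V - Real.log d)‖ = Λ d * (d : ℝ) ^ (-(3 / 4) : ℝ) *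
          ((d : ℝ) ^ (-(1 / 4) : ℝ) * ‖s (V - Real.log d)‖) := by
          rw [div_eq_mul_inv, e1]; ring
      _ ≤ _ := h2
      _ = _ := by
          rw [div_eq_mul_one_div (Λ d) _, e2, mul_add]
          have e3 : (d : ℝ) * ((d : ℝ) ^ (-(3 / 4) : ℝ) * (d : ℝ) ^ (-(1 / 4) : ℝ)) = 1 := by
            rw [← e1]; field_simp
          linear_combination 3 * Real.exp (-V) * Λ d * e3
  have hψ : ∑ d ∈ Finset.Icc 1 ⌊Real.exp V⌋₊, Λ d ≤ B * Real.exp V :=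
    Chebyshev.psi_le_const_mul_self (Real.exp_pos V).le
  have hexp1 : Real.exp (-V) * Real.exp V = 1 := by rw [← Real.exp_add]; simp
  have hAs : ∑ d ∈ Finset.Icc 1 ⌊Real.exp V⌋₊, Λ d / (d : ℝ) ^ (5 / 4 : ℝ) ≤ A :=
    hsum.sum_le_tsum _ fun n _ => div_nonneg vonMangoldt_nonneg (by positivity)
  have hW := sum_mul_integral_window_le (f := fun n => f n) hf hV
  have h3 := norm_logSum_mul_le f hf hV
  have h4 := Finset.sum_le_sum hterm
  rw [Finset.sum_add_distrib, Finset.sum_add_distrib, ← Finset.mul_sum, ← Finset.mul_sum] at h4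
  have h5 : 3 * Real.exp (-V) * ∑ d ∈ Finset.Icc 1 ⌊Real.exp V⌋₊, Λ d ≤ 3 * B := by
    calc _ ≤ 3 * Real.exp (-V) * (B * Real.exp V) := by gcongr
      _ = _ := by linear_combination 3 * B * hexp1
  calc ‖s V‖ * V ≤ J + (276 * J + (2 * A + 3 * B)) := by linarith
    _ ≤ (277 + 2 * A + 3 * B) * (1 + J) := by nlinarith [mul_nonneg hA0 hJ0, mul_nonneg hB0 hJ0]

end

/-! ### Monotonicity, convergence and a lower bound for `HT`. -/

section

open MeasureTheory

/-- The supremum of `‖F(1+s)/s‖²` over the box with index `k`. -/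
noncomputable def boxSup (f : ℕ → ℂ) (T α : ℝ) (k : ℤ) : ℝ :=
  sSup ((fun s : ℂ => ‖LSeries f (1 + s) / s‖ ^ 2) '' boxA k T α)

theorem HT_eq_sqrt_tsum_boxSup (f : ℕ →*₀ ℂ) (T α : ℝ) :
    HT f T α = Real.sqrt (∑' k : ℤ, boxSup (fun n => f n) T α k) := rfl

theorem LSeriesSummable_of_norm_le_one {f : ℕ → ℂ} (hf : ∀ n, ‖f n‖ ≤ 1) {s : ℂ} (hs : 0 < s.re) :
    LSeriesSummable f (1 + s) :=
  LSeriesSummable_of_bounded_of_one_lt_re (m := 1) (fun n _ => hf n) (by simpa using hs)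

theorem exists_norm_LSeries_le {f : ℕ → ℂ} (hf : ∀ n, ‖f n‖ ≤ 1) {α : ℝ} (hα : 0 < α) :
    ∃ M : ℝ, 0 ≤ M ∧ ∀ s : ℂ, α ≤ s.re → ‖LSeries f (1 + s)‖ ≤ M := by
  have hsum := (LSeriesSummable_of_norm_le_one hf (s := α) (by simpa using hα)).norm
  refine ⟨∑' n, ‖LSeries.term f (1 + α) n‖, tsum_nonneg fun _ => norm_nonneg _, fun s hs => ?_⟩
  exact tsum_of_norm_bounded hsum.hasSum fun n =>
    LSeries.norm_term_le_of_re_le_re f (by simpa using hs) n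

theorem norm_div_sq_le_of_le {M r : ℝ} {z s : ℂ} (hz : ‖z‖ ≤ M) (hr : 0 < r) (hs : r ≤ ‖s‖) :
    ‖z / s‖ ^ 2 ≤ (M / r) ^ 2 := by
  rw [norm_div]
  have : 0 ≤ M := (norm_nonneg _).trans hz
  gcongr

theorem le_boxSup {f : ℕ → ℂ} (hf : ∀ n, ‖f n‖ ≤ 1) {T α : ℝ} (hα : 0 < α) {k : ℤ} {s : ℂ}
    (hs : s ∈ boxA k T α) : ‖LSeries f (1 + s) / s‖ ^ 2 ≤ boxSup f T α k := by
  obtain ⟨M, _, hM⟩ := exists_norm_LSeries_le hf hα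
  refine le_csSup ⟨(M / α) ^ 2, ?_⟩ ⟨s, hs, rfl⟩
  rintro _ ⟨w, hw, rfl⟩
  exact norm_div_sq_le_of_le (hM w hw.1) hα
    (hw.1.trans ((le_abs_self _).trans (Complex.abs_re_le_norm w)))

theorem boxSup_nonneg (f : ℕ → ℂ) (T α : ℝ) (k : ℤ) : 0 ≤ boxSup f T α k := by
  refine Real.sSup_nonneg ?_
  rintro _ ⟨w, _, rfl⟩
  positivity

theorem boxSup_anti {f : ℕ → ℂ} (hf : ∀ n, ‖f n‖ ≤ 1) {T α β : ℝ} (hα : 0 < α) (hαβ : α ≤ β)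
    (k : ℤ) : boxSup f T β k ≤ boxSup f T α k := by
  refine Real.sSup_le ?_ (boxSup_nonneg _ _ _ _)
  rintro _ ⟨w, hw, rfl⟩
  exact le_boxSup hf hα ⟨hαβ.trans hw.1, hw.2⟩

theorem summable_boxSup {f : ℕ → ℂ} (hf : ∀ n, ‖f n‖ ≤ 1) {T α : ℝ} (hT : 0 < T) (hα : 0 < α) :
    Summable (boxSup f T α) := by
  obtain ⟨M, hM0, hM⟩ := exists_norm_LSeries_le hf hα
  have hs : Summable fun k : ℤ => (2 * M / T) ^ 2 * (1 / (k : ℝ) ^ 2) :=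
    (Real.summable_one_div_int_pow.2 one_lt_two).mul_left _
  refine hs.of_norm_bounded_eventually ?_
  rw [Filter.eventually_cofinite]
  refine (Set.finite_singleton (0 : ℤ)).subset fun k hk => ?_
  by_contra hk0
  refine hk ?_
  rw [Real.norm_of_nonneg (boxSup_nonneg _ _ _ _)]
  refine Real.sSup_le ?_ (by positivity)
  rintro _ ⟨w, hw, rfl⟩
  have hk1 : (1 : ℝ) ≤ |(k : ℝ)| := by
    exact_mod_cast Int.one_le_abs (by simpa using hk0)
  have hw' : |(k : ℝ)| * T / 2 ≤ ‖w‖ := by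
    refine le_trans ?_ (Complex.abs_im_le_norm w)
    have h1 := abs_sub_abs_le_abs_sub ((k : ℝ) * T) w.im
    rw [abs_sub_comm, abs_mul, abs_of_pos hT] at h1
    have h2 := hw.2.2
    nlinarith
  refine (norm_div_sq_le_of_le (hM w hw.1) (by positivity) hw').trans (le_of_eq ?_)
  rw [← sq_abs (k : ℝ)]
  field_simp

theorem HT_sq {f : ℕ →*₀ ℂ} {T α : ℝ} :
    HT f T α ^ 2 = ∑' k : ℤ, boxSup (fun n => f n) T α k := by
  rw [HT_eq_sqrt_tsum_boxSup, Real.sq_sqrt (tsum_nonneg fun k => boxSup_nonneg _ _ _ _)]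

theorem HT_nonneg (f : ℕ →*₀ ℂ) (T α : ℝ) : 0 ≤ HT f T α := Real.sqrt_nonneg _

theorem HT_anti {f : ℕ →*₀ ℂ} (hf : ∀ n : ℕ, ‖f n‖ ≤ 1) {T α β : ℝ} (hT : 0 < T) (hα : 0 < α)
    (hαβ : α ≤ β) : HT f T β ≤ HT f T α := by
  rw [HT_eq_sqrt_tsum_boxSup, HT_eq_sqrt_tsum_boxSup]
  exact Real.sqrt_le_sqrt ((summable_boxSup hf hT (hα.trans_le hαβ)).tsum_le_tsum
    (boxSup_anti hf hα hαβ) (summable_boxSup hf hT hα))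

/-- The term n = 1 dominates: |F(2)| ≥ 1 - (ζ(2) - 1) = 2 - π²/6 > 1/4. -/
theorem one_fourth_le_norm_LSeries_two {f : ℕ → ℂ} (hf : ∀ n, ‖f n‖ ≤ 1) (hf1 : f 1 = 1) :
    1 / 4 ≤ ‖LSeries f (1 + 1)‖ := by
  have hsum := LSeriesSummable_of_norm_le_one hf (s := 1) (by simp)
  have h1 : HasSum (fun n : ℕ => if n = 1 then (1 : ℂ) else 0) 1 := hasSum_ite_eq 1 1
  have h1' : HasSum (fun n : ℕ => if n = 1 then (1 : ℝ) else 0) 1 := hasSum_ite_eq 1 1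
  have h2 := hsum.hasSum.sub h1
  have h3 := hasSum_zeta_two.sub h1'
  have h4 : ‖LSeries f (1 + 1) - 1‖ ≤ Real.pi ^ 2 / 6 - 1 := by
    rw [LSeries, ← h2.tsum_eq]
    refine tsum_of_norm_bounded h3 fun n => ?_
    rcases eq_or_ne n 0 with rfl | hn0
    · simp
    rcases eq_or_ne n 1 with rfl | hn1
    · simp [LSeries.term_of_ne_zero, hf1]
    · rw [if_neg hn1, if_neg hn1, sub_zero, sub_zero, LSeries.norm_term_eq, if_neg hn0]
      have : ((1 : ℂ) + 1).re = (2 : ℕ) := by norm_num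
      rw [this, Real.rpow_natCast]
      gcongr
      exact hf n
  have h5 : 1 - ‖LSeries f (1 + 1) - 1‖ ≤ ‖LSeries f (1 + 1)‖ := by
    have := norm_sub_norm_le (1 : ℂ) (1 - LSeries f (1 + 1))
    rwa [sub_sub_cancel, norm_one, norm_sub_rev] at this
  have hpi : Real.pi ^ 2 ≤ 3.15 ^ 2 := by
    have := Real.pi_lt_d2
    have := Real.pi_pos
    gcongr
  norm_num at hpi
  have h6 : 1 - (Real.pi ^ 2 / 6 - 1) ≤ ‖LSeries f (1 + 1)‖ := (sub_le_sub_left h4 1).trans h5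
  linarith

/-- The point s = 1 lies in the central box for every α ≤ 1. This lower bound later absorbs additive
constants. -/
theorem one_fourth_le_HT {f : ℕ →*₀ ℂ} (hf : ∀ n : ℕ, ‖f n‖ ≤ 1) {T α : ℝ} (hT : 0 < T)
    (hα : 0 < α) (hα1 : α ≤ 1) : 1 / 4 ≤ HT f T α := by
  rw [HT_eq_sqrt_tsum_boxSup]
  refine Real.le_sqrt_of_sq_le ?_
  have hmem : (1 : ℂ) ∈ boxA 0 T α := by
    refine ⟨by simpa using hα1, by simp, ?_⟩
    simp only [Complex.one_im, Int.cast_zero, zero_mul, sub_zero, abs_zero]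
    positivity
  have h1 := le_boxSup (f := fun n => f n) hf hα hmem
  rw [div_one] at h1
  calc (1 / 4 : ℝ) ^ 2 ≤ ‖LSeries (fun n => f n) (1 + 1)‖ ^ 2 := by
        gcongr
        exact one_fourth_le_norm_LSeries_two hf (map_one f)
    _ ≤ boxSup (fun n => f n) T α 0 := h1
    _ ≤ _ := (summable_boxSup hf hT hα).le_tsum 0 fun k _ => boxSup_nonneg _ _ _ _

end

/-! ### The Laplace transform of the weighted partial sums. -/

section

open MeasureTheory Filter Topology ArithmeticFunction

theorem hasDerivAt_neg_exp_mul_add {s : ℂ} (hs : s ≠ 0) (v : ℝ) :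
    HasDerivAt (fun v : ℝ => -(Complex.exp (-(s * v)) * (v / s + 1 / s ^ 2)))
      (v * Complex.exp (-(s * v))) v := by
  have h1 : HasDerivAt (fun v : ℝ => (v : ℂ)) 1 v := Complex.ofRealCLM.hasDerivAt
  have h2 : HasDerivAt (fun v : ℝ => Complex.exp (-(s * v))) (Complex.exp (-(s * v)) * (-(s * 1))) v :=
    ((h1.const_mul s).neg).cexp
  convert! (h2.mul ((h1.div_const s).add_const (1 / s ^ 2))).neg using 1
  field_simp
  ring

theorem norm_cexp_neg_mul (s : ℂ) (v : ℝ) : ‖Complex.exp (-(s * v))‖ = Real.exp (-s.re * v) := by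
  rw [Complex.norm_exp]
  simp

theorem integrableOn_mul_exp_neg {α : ℝ} (hα : 0 < α) (c : ℝ) :
    IntegrableOn (fun v : ℝ => v * Real.exp (-α * v)) (Set.Ioi c) := by
  refine integrable_of_isBigO_exp_neg (b := α / 2) (by positivity) (by fun_prop) ?_
  refine Asymptotics.isBigO_iff.2 ⟨2 / α, ?_⟩
  filter_upwards [eventually_ge_atTop 0] with v hv
  have h1 := Real.add_one_le_exp (α / 2 * v)
  rw [Real.norm_of_nonneg (by positivity), Real.norm_of_nonneg (by positivity)]
  have h2 : Real.exp (-α * v) = Real.exp (-(α / 2) * v) * Real.exp (-(α / 2) * v) := by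
    rw [← Real.exp_add]; ring_nf
  have h3 : Real.exp (α / 2 * v) * Real.exp (-(α / 2) * v) = 1 := by
    rw [← Real.exp_add]; ring_nf; exact Real.exp_zero
  have h4 : v ≤ 2 / α * Real.exp (α / 2 * v) := by
    rw [div_mul_eq_mul_div, le_div_iff₀ hα]
    linarith
  calc v * Real.exp (-α * v) ≤ 2 / α * Real.exp (α / 2 * v) * Real.exp (-α * v) := by gcongr
    _ = 2 / α * Real.exp (-(α / 2) * v) := by
      rw [h2]; linear_combination (2 / α * Real.exp (-(α / 2) * v)) * h3

theorem integrableOn_mul_cexp_neg {s : ℂ} (hs : 0 < s.re) (c : ℝ) :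
    IntegrableOn (fun v : ℝ => v * Complex.exp (-(s * v))) (Set.Ioi c) := by
  refine Integrable.mono (integrableOn_mul_exp_neg hs c)
    (Continuous.aestronglyMeasurable (by fun_prop)) (.of_forall fun v => ?_)
  rw [norm_mul, norm_mul, norm_cexp_neg_mul, Complex.norm_real, Real.norm_of_nonneg (Real.exp_pos _).le]

theorem integral_Ioi_mul_cexp_neg {s : ℂ} (hs : 0 < s.re) (c : ℝ) :
    ∫ v in Set.Ioi c, (v : ℂ) * Complex.exp (-(s * v)) =
      Complex.exp (-(s * c)) * (c / s + 1 / s ^ 2) := by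
  have hs0 : s ≠ 0 := by rintro rfl; simp at hs
  have ht : Tendsto (fun v : ℝ => -(Complex.exp (-(s * v)) * (v / s + 1 / s ^ 2))) atTop (𝓝 0) := by
    rw [tendsto_zero_iff_norm_tendsto_zero]
    have h1 := tendsto_rpow_mul_exp_neg_mul_atTop_nhds_zero 1 s.re hs
    have h0 := tendsto_rpow_mul_exp_neg_mul_atTop_nhds_zero 0 s.re hs
    have h2 := (h1.mul_const (1 / ‖s‖)).add (h0.mul_const (1 / ‖s‖ ^ 2))
    simp only [zero_mul, add_zero, Real.rpow_one, Real.rpow_zero] at h2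
    refine squeeze_zero' (.of_forall fun v => norm_nonneg _) ?_ h2
    filter_upwards [eventually_ge_atTop 0] with v hv
    rw [norm_neg, norm_mul, norm_cexp_neg_mul]
    calc _ ≤ Real.exp (-s.re * v) * (v / ‖s‖ + 1 / ‖s‖ ^ 2) := by
          gcongr
          refine (norm_add_le _ _).trans (le_of_eq ?_)
          rw [norm_div, norm_div, norm_pow, norm_one, Complex.norm_real, Real.norm_of_nonneg hv]
      _ = _ := by ring
  rw [integral_Ioi_of_hasDerivAt_of_tendsto' (fun v _ => hasDerivAt_neg_exp_mul_add hs0 v)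
    (integrableOn_mul_cexp_neg hs c) ht]
  ring

theorem integral_Ioi_mul_exp_neg {α : ℝ} (hα : 0 < α) (c : ℝ) :
    ∫ v in Set.Ioi c, v * Real.exp (-α * v) = Real.exp (-α * c) * (c / α + 1 / α ^ 2) := by
  have h := integral_Ioi_mul_cexp_neg (s := α) (by simpa using hα) c
  have h2 : ∀ v : ℝ, (v : ℂ) * Complex.exp (-(α * v)) = ((v * Real.exp (-α * v) : ℝ) : ℂ) := by
    intro v
    push_cast
    ring_nf
  simp only [h2] at h
  rw [integral_complex_ofReal] at h
  have h3 : ((∫ v in Set.Ioi c, v * Real.exp (-α * v) : ℝ) : ℂ) =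
      ((Real.exp (-α * c) * (c / α + 1 / α ^ 2) : ℝ) : ℂ) := by
    rw [h]
    push_cast
    ring_nf
  exact_mod_cast h3

/-- The weighted logarithmic partial sum `s(v) v e^{-αv}`. -/
noncomputable def weightedLogSum (f : ℕ → ℂ) (α v : ℝ) : ℂ :=
  logSum f v * (v * Real.exp (-α * v) : ℝ)

theorem measurable_weightedLogSum (f : ℕ → ℂ) (α : ℝ) : Measurable (weightedLogSum f α) :=
  (measurable_logSum f).mul (Complex.measurable_ofReal.comp
    (Continuous.measurable (by fun_prop)))

theorem exists_norm_weightedLogSum_le {f : ℕ → ℂ} (hf : ∀ n, ‖f n‖ ≤ 1) {α : ℝ} (hα : 0 < α) :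
    ∃ C : ℝ, 0 ≤ C ∧ ∀ v, ‖weightedLogSum f α v‖ ≤
      C * (Set.Ici (0 : ℝ)).indicator (fun v => Real.exp (-(α / 2) * v)) v := by
  refine ⟨(1 + 4 / α) * (4 / α), by positivity, fun v => ?_⟩
  rw [weightedLogSum]
  by_cases hv : 0 ≤ v
  · rw [Set.indicator_of_mem (Set.mem_Ici.2 hv), norm_mul, Complex.norm_real,
      Real.norm_of_nonneg (by positivity)]
    have h1 := norm_logSum_le hf hv
    have h2 := Real.add_one_le_exp (α / 4 * v)
    have h4 : v ≤ 4 / α * Real.exp (α / 4 * v) := by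
      rw [div_mul_eq_mul_div, le_div_iff₀ hα]
      linarith
    have h5 : 1 + v ≤ (1 + 4 / α) * Real.exp (α / 4 * v) := by
      have : 1 ≤ Real.exp (α / 4 * v) := Real.one_le_exp (by positivity)
      rw [add_mul, one_mul]
      exact add_le_add this h4
    calc _ ≤ ((1 + 4 / α) * Real.exp (α / 4 * v)) *
          (4 / α * Real.exp (α / 4 * v) * Real.exp (-α * v)) := by
          gcongr
          exact h1.trans h5
      _ = (1 + 4 / α) * (4 / α) *
          (Real.exp (α / 4 * v) * Real.exp (α / 4 * v) * Real.exp (-α * v)) := by ring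
      _ = _ := by
          rw [← Real.exp_add, ← Real.exp_add]
          ring_nf
  · rw [logSum_of_neg f (not_le.1 hv), zero_mul, norm_zero, Set.indicator_of_notMem (by simpa using hv),
      mul_zero]

theorem integrable_indicator_exp {b : ℝ} (hb : 0 < b) :
    Integrable ((Set.Ici (0 : ℝ)).indicator fun v => Real.exp (-b * v)) := by
  rw [integrable_indicator_iff measurableSet_Ici, integrableOn_Ici_iff_integrableOn_Ioi]
  exact exp_neg_integrableOn_Ioi 0 hb

theorem integrable_weightedLogSum {f : ℕ → ℂ} (hf : ∀ n, ‖f n‖ ≤ 1) {α : ℝ} (hα : 0 < α) :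
    Integrable (weightedLogSum f α) := by
  obtain ⟨C, _, hC⟩ := exists_norm_weightedLogSum_le hf hα
  exact ((integrable_indicator_exp (half_pos hα)).const_mul C).mono'
    (measurable_weightedLogSum f α).aestronglyMeasurable (.of_forall hC)

theorem memLp_weightedLogSum {f : ℕ → ℂ} (hf : ∀ n, ‖f n‖ ≤ 1) {α : ℝ} (hα : 0 < α) :
    MemLp (weightedLogSum f α) 2 := by
  obtain ⟨C, hC0, hC⟩ := exists_norm_weightedLogSum_le hf hα
  have hm := (measurable_weightedLogSum f α).aestronglyMeasurable (μ := volume)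
  refine (memLp_two_iff_integrable_sq_norm hm).2 ?_
  refine ((integrable_indicator_exp hα).const_mul (C ^ 2)).mono' (hm.norm.pow 2)
    (.of_forall fun v => ?_)
  rw [norm_pow, norm_norm]
  refine (pow_le_pow_left₀ (norm_nonneg _) (hC v) 2).trans (le_of_eq ?_)
  rw [mul_pow]
  congr 1
  by_cases hv : v ∈ Set.Ici (0 : ℝ)
  · rw [Set.indicator_of_mem hv, Set.indicator_of_mem hv, sq, ← Real.exp_add]
    ring_nf
  · rw [Set.indicator_of_notMem hv, Set.indicator_of_notMem hv]
    simp

theorem cexp_neg_mul_log_mul_div {n : ℕ} (hn : n ≠ 0) (f : ℕ → ℂ) (s : ℂ) :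
    f n / n * Complex.exp (-(s * (Real.log n : ℝ))) = LSeries.term f (1 + s) n := by
  have hn' : (n : ℂ) ≠ 0 := Nat.cast_ne_zero.2 hn
  rw [LSeries.term_of_ne_zero hn, Complex.cpow_add _ _ hn', Complex.cpow_one,
    Complex.cpow_def_of_ne_zero hn' s, ← Complex.natCast_log, Complex.exp_neg, div_mul_eq_div_div,
    div_eq_mul_inv (f n / n), mul_comm s]

/-- The right side is -(F(1+s)/s)'. Each n contributes f(n)/n · ∫_{log n}^∞ v e^(-sv) dv, and
absolute convergence of F and F' at 1 + s justifies termwise integration. -/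
theorem integral_weightedLogSum_mul_cexp {f : ℕ → ℂ} (hf : ∀ n, ‖f n‖ ≤ 1) {α : ℝ} (hα : 0 < α)
    (t : ℝ) {s : ℂ} (hs : s = α + Complex.I * t) :
    ∫ v, weightedLogSum f α v * Complex.exp (-(Complex.I * t * v)) =
      LSeries (LSeries.logMul f) (1 + s) / s + LSeries f (1 + s) / s ^ 2 := by
  have hre : s.re = α := by simp [hs]
  have hs0 : 0 < s.re := by rwa [hre]
  have habs : LSeries.abscissaOfAbsConv f < (1 + s).re := by
    refine (LSeries.abscissaOfAbsConv_le_of_le_const ⟨1, fun n _ => hf n⟩).trans_lt ?_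
    exact_mod_cast (by simpa using hs0 : 1 < (1 + s).re)
  have hsum1 : LSeriesSummable (LSeries.logMul f) (1 + s) := LSeriesSummable_logMul_of_lt_re habs
  have hsum0 : LSeriesSummable f (1 + s) := LSeriesSummable_of_norm_le_one hf hs0
  set F : ℕ → ℝ → ℂ := fun n => (Set.Ici (Real.log n)).indicator fun v =>
    if n = 0 then 0 else f n / n * (v * Complex.exp (-(s * v))) with hF
  have hint : ∀ n, Integrable (F n) := by
    intro n
    rw [hF, integrable_indicator_iff measurableSet_Ici, integrableOn_Ici_iff_integrableOn_Ioi]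
    rcases eq_or_ne n 0 with rfl | hn
    · simp
    · simp only [if_neg hn]
      exact (integrableOn_mul_cexp_neg hs0 _).const_mul _
  have hval : ∀ n, ∫ v, F n v = LSeries.term (LSeries.logMul f) (1 + s) n / s +
      LSeries.term f (1 + s) n / s ^ 2 := by
    intro n
    rw [hF, integral_indicator measurableSet_Ici, integral_Ici_eq_integral_Ioi]
    rcases eq_or_ne n 0 with rfl | hn
    · simp
    · simp only [if_neg hn]
      rw [integral_const_mul, integral_Ioi_mul_cexp_neg hs0, ← mul_assoc,
        cexp_neg_mul_log_mul_div hn, LSeries.term_of_ne_zero hn, LSeries.term_of_ne_zero hn,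
        LSeries.logMul, Complex.natCast_log]
      ring
  have hnorm : ∀ n, ∫ v, ‖F n v‖ ≤ ‖LSeries.term (LSeries.logMul f) (1 + s) n‖ / α +
      ‖LSeries.term f (1 + s) n‖ / α ^ 2 := by
    intro n
    rcases eq_or_ne n 0 with rfl | hn
    · simp [hF]
    have e1 : ∀ v, ‖F n v‖ = (Set.Ici (Real.log n)).indicator (fun v =>
        ‖f n / n‖ * (v * Real.exp (-α * v))) v := by
      intro v
      rw [hF]
      simp only [if_neg hn]
      rw [norm_indicator_eq_indicator_norm]
      by_cases hv : v ∈ Set.Ici (Real.log n)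
      · rw [Set.indicator_of_mem hv, Set.indicator_of_mem hv, norm_mul, norm_mul,
          norm_cexp_neg_mul, hre, Complex.norm_real,
          Real.norm_of_nonneg ((Real.log_natCast_nonneg n).trans hv)]
      · rw [Set.indicator_of_notMem hv, Set.indicator_of_notMem hv]
    simp only [e1]
    rw [integral_indicator measurableSet_Ici, integral_Ici_eq_integral_Ioi, integral_const_mul,
      integral_Ioi_mul_exp_neg hα]
    have e2 : ‖LSeries.term f (1 + s) n‖ = ‖f n / n‖ * Real.exp (-α * Real.log n) := by
      rw [← cexp_neg_mul_log_mul_div hn, norm_mul, norm_cexp_neg_mul, hre]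
    have e3 : ‖LSeries.term (LSeries.logMul f) (1 + s) n‖ =
        Real.log n * ‖LSeries.term f (1 + s) n‖ := by
      rw [LSeries.norm_term_eq, LSeries.norm_term_eq, if_neg hn, if_neg hn, LSeries.logMul,
        norm_mul, ← Complex.natCast_log, Complex.norm_real,
        Real.norm_of_nonneg (Real.log_natCast_nonneg n)]
      ring
    rw [e3, e2]
    refine le_of_eq ?_
    ring
  have hsumnorm : Summable fun n => ∫ v, ‖F n v‖ :=
    ((hsum1.norm.div_const α).add (hsum0.norm.div_const (α ^ 2))).of_nonneg_of_le
      (fun n => integral_nonneg fun v => norm_nonneg _) hnorm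
  have hmain := hasSum_integral_of_summable_integral_norm hint hsumnorm
  have hR := (hsum1.hasSum.div_const s).add (hsum0.hasSum.div_const (s ^ 2))
  simp only [hval] at hmain
  rw [← LSeries, ← LSeries] at hR
  rw [hR.unique hmain]
  refine integral_congr_ae (.of_forall fun v => ?_)
  simp only
  have hFv : ∀ n ∉ Finset.Icc 1 ⌊Real.exp v⌋₊, F n v = 0 := by
    intro n hn
    rcases eq_or_ne n 0 with rfl | hn0
    · simp [hF]
    rw [Finset.mem_Icc, not_and] at hn
    refine Set.indicator_of_notMem (fun hv => ?_) _
    exact hn (by omega) ((log_natCast_le_iff (by omega) v).1 hv)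
  rw [tsum_eq_sum hFv, weightedLogSum, logSum, Finset.sum_mul, Finset.sum_mul]
  refine Finset.sum_congr rfl fun n hn => ?_
  have hn := Finset.mem_Icc.1 hn
  have hmem : v ∈ Set.Ici (Real.log n) := (log_natCast_le_iff hn.1 v).2 hn.2
  simp only [hF]
  rw [Set.indicator_of_mem hmem, if_neg (by omega), mul_assoc]
  congr 1
  push_cast
  rw [mul_assoc, ← Complex.exp_add, hs]
  congr 2
  ring

end

/-! ### The mean-square bound, dyadic summation and the theorem. -/

section

open MeasureTheory ArithmeticFunction

theorem convolution_mul_vonMangoldt (f : ℕ →*₀ ℂ) :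
    LSeries.convolution (fun n => f n * (Λ n : ℂ)) (fun n => f n) =
      LSeries.logMul fun n => f n := by
  funext n
  rw [LSeries.convolution_def, LSeries.logMul, ← Complex.natCast_log, ← vonMangoldt_sum,
    ← Nat.sum_divisorsAntidiagonal (fun i _ => Λ i)]
  push_cast
  rw [Finset.sum_mul]
  refine Finset.sum_congr rfl fun p hp => ?_
  rw [← (Nat.mem_divisorsAntidiagonal.1 hp).1, map_mul]
  ring

theorem LSeriesSummable_mul_vonMangoldt {f : ℕ → ℂ} (hf : ∀ n, ‖f n‖ ≤ 1) {s : ℂ}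
    (hs : 0 < s.re) : LSeriesSummable (fun n => f n * (Λ n : ℂ)) (1 + s) := by
  have h := (LSeriesSummable_vonMangoldt (s := 1 + s) (by simpa using hs)).norm
  refine Summable.of_norm (h.of_nonneg_of_le (fun n => norm_nonneg _) fun n =>
    LSeries.norm_term_le _ ?_)
  rw [norm_mul]
  exact mul_le_of_le_one_left (norm_nonneg _) (hf n)

/-- This is -F' = (-F'/F)·F, with -F'/F given as the Dirichlet series of fΛ. -/
theorem LSeries_logMul_eq (f : ℕ →*₀ ℂ) (hf : ∀ n : ℕ, ‖f n‖ ≤ 1) {s : ℂ} (hs : 0 < s.re) :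
    LSeries (LSeries.logMul fun n => f n) (1 + s) =
      LSeries (fun n => f n * (Λ n : ℂ)) (1 + s) * LSeries (fun n => f n) (1 + s) := by
  rw [← convolution_mul_vonMangoldt]
  exact LSeries_convolution' (LSeriesSummable_mul_vonMangoldt (f := fun n => f n) hf hs)
    (LSeriesSummable_of_norm_le_one hf hs)

theorem continuous_LSeries_vertical {g : ℕ → ℂ} {σ : ℂ} (hg : LSeriesSummable g σ) :
    Continuous fun t : ℝ => LSeries g (σ + Complex.I * t) := by
  simp only [LSeries, LSeries_term_add_I_mul]
  exact continuous_tsum_mul_cexp hg.norm _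

/-- The mean square of the weighted logarithmic partial sums is controlled by `HT`. -/
theorem exists_lintegral_weightedLogSum_le :
    ∃ K : ℝ, 0 ≤ K ∧ ∀ f : ℕ →*₀ ℂ, (∀ n : ℕ, ‖f n‖ ≤ 1) → ∀ T α : ℝ, 0 < T → T ≤ 1 → 0 < α →
      α ≤ 1 → ∫⁻ v, ‖weightedLogSum (fun n => f n) α v‖ₑ ^ 2 ≤
        ENNReal.ofReal (K * HT f T α ^ 2 / α) := by
  obtain ⟨K, hK0, hK⟩ := exists_integral_norm_sq_LSeries_mul_vonMangoldt_le
  refine ⟨2 * (K + Real.pi), by positivity, fun f hf T α hT hT1 hα hα1 => ?_⟩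
  set F : ℝ → ℂ := fun t => LSeries (fun n => f n) (1 + (α + Complex.I * t)) with hF
  set P : ℝ → ℂ := fun t => LSeries (fun n => f n * (Λ n : ℂ)) (1 + α + Complex.I * t) with hP
  set G : ℝ → ℂ := fun t => F t / (α + Complex.I * t) * (P t + 1 / (α + Complex.I * t)) with hG
  have hre : ∀ t : ℝ, (α + Complex.I * t : ℂ).re = α := by intro t; simp
  have him : ∀ t : ℝ, (α + Complex.I * t : ℂ).im = t := by intro t; simp
  have hlap : ∀ t : ℝ, ∫ v, weightedLogSum (fun n => f n) α v *
      Complex.exp (-(Complex.I * t * v)) = G t := by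
    intro t
    rw [integral_weightedLogSum_mul_cexp (f := fun n => f n) hf hα t rfl,
      LSeries_logMul_eq f hf (by rw [hre]; exact hα)]
    simp only [hG, hF, hP, add_assoc]
    generalize (α + Complex.I * t : ℂ) = z
    ring
  have hPc : Continuous P := continuous_LSeries_vertical
    (LSeriesSummable_mul_vonMangoldt (f := fun n => f n) hf (s := α) (by simpa using hα))
  have hPc2 : Continuous fun t => ‖P t‖ ^ 2 := hPc.norm.pow 2
  have hnorm : ∀ t : ℝ, ‖(α + Complex.I * t : ℂ)‖ ^ 2 = α ^ 2 + t ^ 2 := by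
    intro t
    rw [← Complex.normSq_eq_norm_sq, Complex.normSq_apply, hre, him]
    ring
  set w : ℝ → ℝ := fun t => 2 * (‖P t‖ ^ 2 + 1 / (α ^ 2 + t ^ 2)) with hw
  have hw0 : ∀ t, 0 ≤ w t := fun t => by positivity
  have hwc1 : Continuous fun t : ℝ => 1 / (α ^ 2 + t ^ 2) :=
    continuous_const.div (by fun_prop) fun t => by positivity
  have hwc : Continuous w := by fun_prop
  -- These intervals, centred at kT, tile the line; on the k-th one α + it lies in box k, so F/s is
  -- bounded by the box supremum and w majorizes the square of the remaining factor.
  have hbox : ∀ k : ℤ, ∀ t ∈ Set.Ioc (-(T / 2) + k • T) (-(T / 2) + (k + 1) • T),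
      ‖G t‖ ^ 2 ≤ boxSup (fun n => f n) T α k * w t := by
    intro k t ht
    simp only [zsmul_eq_mul, Int.cast_add, Int.cast_one] at ht
    have hmem : (α + Complex.I * t : ℂ) ∈ boxA k T α := by
      refine ⟨(hre t).ge, (hre t).trans_le hα1, ?_⟩
      rw [him, abs_le]
      constructor <;> linarith [ht.1, ht.2]
    have h1 := le_boxSup (f := fun n => f n) hf hα hmem
    rw [hG]
    simp only
    rw [norm_mul, mul_pow]
    gcongr
    · exact boxSup_nonneg _ _ _ _
    · calc _ ≤ (‖P t‖ + ‖1 / (α + Complex.I * t : ℂ)‖) ^ 2 := by gcongr; exact norm_add_le _ _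
        _ ≤ 2 * (‖P t‖ ^ 2 + ‖1 / (α + Complex.I * t : ℂ)‖ ^ 2) := add_sq_le
        _ = w t := by rw [hw, norm_div, norm_one, div_pow, one_pow, hnorm]
  have hwint : ∀ k : ℤ, ∫⁻ t in Set.Ioc (-(T / 2) + k • T) (-(T / 2) + (k + 1) • T),
      ENNReal.ofReal (w t) ≤ ENNReal.ofReal (2 * (K + Real.pi) / α) := by
    intro k
    simp only [zsmul_eq_mul, Int.cast_add, Int.cast_one]
    -- As T ≤ 1, the interval may be enlarged to length one, where the mean-square bound applies.
    set a : ℝ := k * T - 1 / 2 with ha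
    set b : ℝ := k * T + 1 / 2 with hb
    have hab : a ≤ b := by linarith
    calc _ ≤ ∫⁻ t in Set.Ioc a b, ENNReal.ofReal (w t) :=
          lintegral_mono_set (Set.Ioc_subset_Ioc (by linarith) (by linarith))
      _ = ENNReal.ofReal (∫ t in a..b, w t) := by
          rw [intervalIntegral.integral_of_le hab,
            ofReal_integral_eq_lintegral_ofReal (hwc.integrableOn_Ioc) (.of_forall hw0)]
      _ ≤ _ := by
          refine ENNReal.ofReal_le_ofReal ?_
          rw [hw, intervalIntegral.integral_const_mul, intervalIntegral.integral_add
            (hPc2.intervalIntegrable _ _) (hwc1.intervalIntegrable _ _)]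
          have h1 := hK (fun n => f n) hf α hα hα1 (k * T)
          have h2 := integral_one_div_sq_add_sq_le hα a b
          calc _ ≤ 2 * (K / α + Real.pi / α) := by gcongr
            _ = _ := by ring
  calc _ ≤ ∫⁻ t, ‖G t‖ₑ ^ 2 := lintegral_enorm_sq_le_of_laplace (integrable_weightedLogSum hf hα)
        (memLp_weightedLogSum hf hα) hlap
    _ = ∫⁻ t in ⋃ k : ℤ, Set.Ioc (-(T / 2) + k • T) (-(T / 2) + (k + 1) • T), ‖G t‖ₑ ^ 2 := by
        rw [iUnion_Ioc_add_zsmul hT, setLIntegral_univ]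
    _ ≤ ∑' k : ℤ, ∫⁻ t in Set.Ioc (-(T / 2) + k • T) (-(T / 2) + (k + 1) • T), ‖G t‖ₑ ^ 2 :=
        lintegral_iUnion_le _ _
    _ ≤ ∑' k : ℤ, ENNReal.ofReal (boxSup (fun n => f n) T α k) *
          ENNReal.ofReal (2 * (K + Real.pi) / α) := by
        refine ENNReal.tsum_le_tsum fun k => ?_
        calc _ ≤ ∫⁻ t in Set.Ioc (-(T / 2) + k • T) (-(T / 2) + (k + 1) • T),
              ENNReal.ofReal (boxSup (fun n => f n) T α k) * ENNReal.ofReal (w t) := by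
              refine setLIntegral_mono' measurableSet_Ioc fun t ht => ?_
              rw [← ENNReal.ofReal_mul (boxSup_nonneg _ _ _ _), ← ofReal_norm,
                ← ENNReal.ofReal_pow (norm_nonneg _)]
              exact ENNReal.ofReal_le_ofReal (hbox k t ht)
          _ ≤ _ := by
              rw [lintegral_const_mul _ hwc.measurable.ennreal_ofReal]
              gcongr
              exact hwint k
    _ = _ := by
        rw [ENNReal.tsum_mul_right, ← ENNReal.ofReal_tsum_of_nonneg
          (fun k => boxSup_nonneg _ _ _ _) (summable_boxSup hf hT hα), ← HT_sq,
          ← ENNReal.ofReal_mul (sq_nonneg _)]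
        congr 1
        ring

theorem exists_integral_weightedLogSum_le :
    ∃ K : ℝ, 0 ≤ K ∧ ∀ f : ℕ →*₀ ℂ, (∀ n : ℕ, ‖f n‖ ≤ 1) → ∀ T α : ℝ, 0 < T → T ≤ 1 → 0 < α →
      α ≤ 1 → ∀ a b : ℝ, a ≤ b →
        ∫ v in a..b, ‖weightedLogSum (fun n => f n) α v‖ ^ 2 ≤ K * HT f T α ^ 2 / α := by
  obtain ⟨K, hK0, hK⟩ := exists_lintegral_weightedLogSum_le
  refine ⟨K, hK0, fun f hf T α hT hT1 hα hα1 a b hab => ?_⟩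
  have hm := (measurable_weightedLogSum (fun n => f n) α)
  have hi : Integrable fun v => ‖weightedLogSum (fun n => f n) α v‖ ^ 2 :=
    (memLp_two_iff_integrable_sq_norm hm.aestronglyMeasurable).1 (memLp_weightedLogSum hf hα)
  rw [intervalIntegral.integral_of_le hab]
  refine (setIntegral_le_integral hi (.of_forall fun v => by positivity)).trans ?_
  rw [← ENNReal.ofReal_le_ofReal_iff (by positivity),
    ofReal_integral_eq_lintegral_ofReal hi (.of_forall fun v => by positivity)]
  refine le_trans (le_of_eq (lintegral_congr fun v => ?_)) (hK f hf T α hT hT1 hα hα1)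
  rw [← ofReal_norm, ENNReal.ofReal_pow (norm_nonneg _)]

/-- The first moment of the logarithmic partial sums over a dyadic range is controlled by `HT`. -/
theorem exists_integral_logSum_dyadic_le :
    ∃ C : ℝ, 0 ≤ C ∧ ∀ f : ℕ →*₀ ℂ, (∀ n : ℕ, ‖f n‖ ≤ 1) → ∀ T : ℝ, 0 < T → T ≤ 1 → ∀ V : ℝ,
      2 ≤ V → ∫ v in (V / 2)..V, ‖logSum (fun n => f n) v‖ ≤ C * HT f T (2 / V) := by
  obtain ⟨K, hK0, hK⟩ := exists_integral_weightedLogSum_le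
  refine ⟨Real.exp 2 * (K + 1), by positivity, fun f hf T hT hT1 V hV => ?_⟩
  -- With this choice 1 ≤ αv ≤ 2 on [V/2, V], so the weight v·e^(-αv) is at least e^(-2)/α there.
  set α := 2 / V with hα'
  have hV0 : 0 < V := by linarith
  have hα : 0 < α := by positivity
  have hα1 : α ≤ 1 := (div_le_one hV0).2 hV
  set H := HT f T α with hH
  have hH0 : 0 < H := by linarith [one_fourth_le_HT hf hT hα hα1]
  have hVα : V * α = 2 := by rw [hα']; field_simp
  have hm := (measurable_weightedLogSum (fun n => f n) α)
  have hi : Integrable fun v => ‖weightedLogSum (fun n => f n) α v‖ ^ 2 :=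
    (memLp_two_iff_integrable_sq_norm hm.aestronglyMeasurable).1 (memLp_weightedLogSum hf hα)
  have hpt : ∀ v ∈ Set.Icc (V / 2) V, ‖logSum (fun n => f n) v‖ ≤
      Real.exp 2 * α * (1 / H * ‖weightedLogSum (fun n => f n) α v‖ ^ 2 + H) := by
    intro v hv
    have hv0 : 0 < v := by linarith [hv.1]
    have h1 : ‖weightedLogSum (fun n => f n) α v‖ =
        ‖logSum (fun n => f n) v‖ * (v * Real.exp (-α * v)) := by
      rw [weightedLogSum, norm_mul, Complex.norm_real, Real.norm_of_nonneg (by positivity)]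
    set x := ‖weightedLogSum (fun n => f n) α v‖ with hx
    have h2 : 1 ≤ Real.exp 2 * α * (v * Real.exp (-α * v)) := by
      have h3 : 1 ≤ α * v := by nlinarith [hv.1]
      have h4 : 1 ≤ Real.exp 2 * Real.exp (-α * v) := by
        rw [← Real.exp_add]
        exact Real.one_le_exp (by nlinarith [hv.2])
      nlinarith
    -- A pointwise substitute for Cauchy–Schwarz: the scale H balances the mean square ≪ H²/α
    -- against the length V/2 = 1/α.
    have h5 : x ≤ 1 / H * x ^ 2 + H := by
      have : 1 / H * x ^ 2 + H - x = ((x - H / 2) ^ 2 + 3 / 4 * H ^ 2) / H := by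
        field_simp; ring
      have h6 : 0 ≤ ((x - H / 2) ^ 2 + 3 / 4 * H ^ 2) / H := by positivity
      linarith
    calc ‖logSum (fun n => f n) v‖ ≤
          ‖logSum (fun n => f n) v‖ * (Real.exp 2 * α * (v * Real.exp (-α * v))) :=
          le_mul_of_one_le_right (norm_nonneg _) h2
      _ = Real.exp 2 * α * x := by rw [h1]; ring
      _ ≤ _ := by gcongr
  have hint : IntervalIntegrable (fun v => ‖weightedLogSum (fun n => f n) α v‖ ^ 2) volume (V / 2) V :=
    hi.intervalIntegrable
  calc _ ≤ ∫ v in (V / 2)..V,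
        Real.exp 2 * α * (1 / H * ‖weightedLogSum (fun n => f n) α v‖ ^ 2 + H) :=
        intervalIntegral.integral_mono_on (by linarith)
          (intervalIntegrable_norm_logSum hf _ _)
          (((hint.const_mul _).add intervalIntegrable_const).const_mul _) hpt
    _ = Real.exp 2 * α * (1 / H * (∫ v in (V / 2)..V,
        ‖weightedLogSum (fun n => f n) α v‖ ^ 2) + (V / 2) * H) := by
        rw [intervalIntegral.integral_const_mul, intervalIntegral.integral_add (hint.const_mul _)
          intervalIntegrable_const, intervalIntegral.integral_const_mul,
          intervalIntegral.integral_const, smul_eq_mul]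
        ring
    _ ≤ Real.exp 2 * α * (1 / H * (K * H ^ 2 / α) + (V / 2) * H) := by
        gcongr
        exact hK f hf T α hT hT1 hα hα1 _ _ (by linarith)
    _ = Real.exp 2 * (K + 1) * H := by
        have e1 : α * (1 / H * (K * H ^ 2 / α)) = K * H := by field_simp
        linear_combination Real.exp 2 * e1 + Real.exp 2 * H / 2 * hVα

theorem intervalIntegrable_HT_div {f : ℕ →*₀ ℂ} (hf : ∀ n : ℕ, ‖f n‖ ≤ 1) {T a b : ℝ} (hT : 0 < T)
    (ha : 0 < a) (hb : 0 < b) : IntervalIntegrable (fun α => HT f T α / α) volume a b := by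
  refine AntitoneOn.intervalIntegrable fun x hx y hy hxy => ?_
  have hx0 : 0 < x := (lt_min ha hb).trans_le hx.1
  have := HT_anti hf hT hx0 hxy
  have := HT_nonneg f T x
  gcongr

theorem integral_HT_div_nonneg (f : ℕ →*₀ ℂ) (T : ℝ) {a b : ℝ} (ha : 0 < a) (hab : a ≤ b) :
    0 ≤ ∫ α in a..b, HT f T α / α :=
  intervalIntegral.integral_nonneg hab fun α hα =>
    div_nonneg (HT_nonneg f T α) (ha.le.trans hα.1)

theorem exists_integral_norm_logSum_le :
    ∃ C : ℝ, 0 ≤ C ∧ ∀ f : ℕ →*₀ ℂ, (∀ n : ℕ, ‖f n‖ ≤ 1) → ∀ T : ℝ, 0 < T → T ≤ 1 → ∀ V : ℝ,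
      1 ≤ V → ∫ v in (0 : ℝ)..V, ‖logSum (fun n => f n) v‖ ≤
        6 + C * ∫ α in (1 / V)..1, HT f T α / α := by
  obtain ⟨C, hC0, hC⟩ := exists_integral_logSum_dyadic_le
  refine ⟨2 * C, by positivity, fun f hf T hT hT1 => ?_⟩
  -- Induction on dyadic scale by halving V. For V ≤ 2 the integrand is at most 3, whence the
  -- constant 6.
  have key : ∀ n : ℕ, ∀ V : ℝ, 1 ≤ V → V ≤ 2 ^ (n + 1) →
      ∫ v in (0 : ℝ)..V, ‖logSum (fun n => f n) v‖ ≤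
        6 + 2 * C * ∫ α in (1 / V)..1, HT f T α / α := by
    intro n
    induction n with
    | zero =>
      intro V hV hV2
      have h0 := integral_HT_div_nonneg f T (a := 1 / V) (b := 1) (by positivity)
        ((div_le_one (by linarith)).2 hV)
      have h1 : ∫ v in (0 : ℝ)..V, ‖logSum (fun n => f n) v‖ ≤ ∫ v in (0 : ℝ)..V, (3 : ℝ) := by
        refine intervalIntegral.integral_mono_on (by linarith)
          (intervalIntegrable_norm_logSum hf _ _) intervalIntegrable_const fun v hv => ?_
        have := norm_logSum_le (f := fun n => f n) hf hv.1
        norm_num at hV2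
        linarith [hv.2]
      rw [intervalIntegral.integral_const, smul_eq_mul] at h1
      norm_num at hV2
      have : 0 ≤ 2 * C * ∫ α in (1 / V)..1, HT f T α / α := by positivity
      linarith
    | succ n ih =>
      intro V hV hVn
      rcases le_or_gt V 2 with h2 | h2
      · refine (ih V hV (h2.trans ?_))
        rw [pow_succ]
        linarith [one_le_pow₀ (one_le_two : (1 : ℝ) ≤ 2) (n := n)]
      have hV0 : 0 < V := by linarith
      have h3 := ih (V / 2) (by linarith) (by rw [pow_succ] at hVn; linarith)
      have h4 := hC f hf T hT hT1 V h2.le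
      rw [← intervalIntegral.integral_add_adjacent_intervals (b := V / 2)
        (intervalIntegrable_norm_logSum hf _ _) (intervalIntegrable_norm_logSum hf _ _)]
      rw [show 1 / (V / 2) = 2 / V by field_simp] at h3
      have hpos : 0 < 2 / V := by positivity
      have hlt : 1 / V ≤ 2 / V := by gcongr; norm_num
      rw [← intervalIntegral.integral_add_adjacent_intervals (a := 1 / V) (b := 2 / V)
        (intervalIntegrable_HT_div hf hT (by positivity) hpos)
        (intervalIntegrable_HT_div hf hT hpos one_pos)]
      -- The integrand decreases, so it is at least its value at 2/V, over an interval of length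
      -- 1/V. The halving here is why the constant is 2C.
      have h5 : HT f T (2 / V) / 2 ≤ ∫ α in (1 / V)..(2 / V), HT f T α / α := by
        have h6 := intervalIntegral.integral_mono_on (a := 1 / V) (b := 2 / V) hlt
          (f := fun _ => HT f T (2 / V) / (2 / V)) intervalIntegrable_const
          (intervalIntegrable_HT_div hf hT (by positivity) hpos) fun α hα => by
            have hα0 : 0 < α := lt_of_lt_of_le (by positivity) hα.1
            have := HT_anti hf hT hα0 hα.2
            have := HT_nonneg f T α
            exact div_le_div₀ this ‹_› hα0 hα.2
        rw [intervalIntegral.integral_const, smul_eq_mul] at h6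
        refine le_trans (le_of_eq ?_) h6
        field_simp
        ring
      have h7 := mul_le_mul_of_nonneg_left h5 hC0
      linarith
  intro V hV
  obtain ⟨n, hn⟩ := pow_unbounded_of_one_lt V (one_lt_two : (1 : ℝ) < 2)
  refine key n V hV (hn.le.trans ?_)
  gcongr
  · norm_num
  · omega

theorem log_le_integral_HT_div {f : ℕ →*₀ ℂ} (hf : ∀ n : ℕ, ‖f n‖ ≤ 1) {T V : ℝ} (hT : 0 < T)
    (hV : 1 ≤ V) : 1 / 4 * Real.log V ≤ ∫ α in (1 / V)..1, HT f T α / α := by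
  have hV0 : 0 < V := by linarith
  have hpos : 0 < 1 / V := by positivity
  have hle : 1 / V ≤ 1 := (div_le_one hV0).2 hV
  have h1 : ∫ α in (1 / V)..1, 1 / 4 * α⁻¹ = 1 / 4 * Real.log V := by
    rw [intervalIntegral.integral_const_mul, integral_inv_of_pos hpos one_pos, one_div_one_div]
  rw [← h1]
  refine intervalIntegral.integral_mono_on hle ?_ (intervalIntegrable_HT_div hf hT hpos one_pos) ?_
  · refine (intervalIntegral.intervalIntegrable_inv (fun x hx => ?_) continuousOn_id).const_mul _
    rw [Set.uIcc_of_le hle] at hx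
    exact (hpos.trans_le hx.1).ne'
  · intro α hα
    have hα0 := hpos.trans_le hα.1
    rw [div_eq_mul_inv (HT f T α)]
    exact mul_le_mul_of_nonneg_right (one_fourth_le_HT hf hT hα0 hα.2) (inv_nonneg.2 hα0.le)

theorem theorem5p1 (x₀ : ℝ) (hx₀ : Real.exp 1 < x₀) :
    ∃ C : ℝ, 0 < C ∧ ∀ f : ℕ →*₀ ℂ, (∀ n : ℕ, ‖f n‖ ≤ 1) →
      ∀ x : ℝ, x₀ ≤ x → ∀ T : ℝ, 0 < T → T ≤ 1 →
        ‖∑ n ∈ Finset.Icc 1 ⌊x⌋₊, f n / (n : ℂ)‖ ≤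
          C * (1 / Real.log x * ∫ α in (1 / Real.log x)..1, HT f T α / α) := by
  obtain ⟨A, hA0, hA⟩ := exists_norm_logSum_mul_le
  obtain ⟨B, hB0, hB⟩ := exists_integral_norm_logSum_le
  have hx₀0 : 0 < x₀ := (Real.exp_pos 1).trans hx₀
  have hlog : 1 < Real.log x₀ := (Real.lt_log_iff_exp_lt hx₀0).2 hx₀
  -- A lower bound for the integral, uniform in x ≥ x₀; it is positive exactly because x₀ > e.
  set m := 1 / 4 * Real.log (Real.log x₀) with hm
  have hm0 : 0 < m := by
    have := Real.log_pos hlog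
    positivity
  -- Here 7 = 1 + 6 collects the additive constants of the two bounds, absorbed through I ≥ m; the
  -- final + 1 only secures positivity.
  refine ⟨A * (7 / m + B) + 1, by positivity, fun f hf x hx T hT hT1 => ?_⟩
  have hx0 : 0 < x := hx₀0.trans_le hx
  set V := Real.log x with hV
  have hVV : Real.log x₀ ≤ V := Real.log_le_log hx₀0 hx
  have hV1 : 1 ≤ V := by linarith
  have hV0 : 0 < V := by linarith
  set I := ∫ α in (1 / V)..1, HT f T α / α with hI
  have hmI : m ≤ I := by
    refine le_trans ?_ (log_le_integral_HT_div hf hT hV1)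
    rw [hm]
    gcongr
  have h1 := hA f hf V hV0.le
  have h2 := hB f hf T hT hT1 V hV1
  have h3 : (∑ n ∈ Finset.Icc 1 ⌊x⌋₊, f n / (n : ℂ)) = logSum (fun n => f n) V := by
    rw [logSum, hV, Real.exp_log hx0]
  have h4 : 7 ≤ 7 / m * I := by
    rw [div_mul_eq_mul_div, le_div_iff₀ hm0]
    gcongr
  rw [h3, one_div_mul_eq_div, ← mul_div_assoc, le_div_iff₀ hV0]
  calc _ ≤ A * (1 + ∫ v in (0 : ℝ)..V, ‖logSum (fun n => f n) v‖) := h1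
    _ ≤ A * (7 / m * I + B * I) := by
        refine mul_le_mul_of_nonneg_left ?_ hA0
        linarith
    _ ≤ (A * (7 / m + B) + 1) * I := by
        have : 0 ≤ I := hm0.le.trans hmI
        linarith

end
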